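/- Let $n \ge 0$ be an integer and let $U_{\mathrm{loc}} = \{u \in \mathbb{R}^n \mid u_i \le 0 \text{ for all } i\}$. Let $R$ be either the formal power series ring $k[[x_1,\dots,x_n]]$ over an arbitrary field $k$, or the ring $\mathcal{O}_0 = \mathbb{C}\{x_1,\dots,x_n\}$ of power series over $\mathbb{C}$ that converge absolutely in some neighbourhood of $0$. For $u \in U_{\mathrm{loc}}$ let $\mathrm{gr}^u(R)$ be the associated graded ring of $R$ for the filtration by $u$-weight ($x^\alpha$ has weight $u\cdot\alpha$), identified with the subring of $R$ consisting of the series whose exponents take only finitely many distinct $u$-weights. For a nonzero $f = \sum_\alpha c_\alpha x^\alpha \in R$ let $\mathrm{in}_u(f)$ be the sum of the terms $c_\alpha x^\alpha$ of $f$ with $c_\alpha \ne 0$ for which $u\cdot\alpha$ is maximal, and put $\mathrm{in}_u(0)=0$. For an ideal $I \subset R$ let $\mathrm{in}_u(I)$ be the ideal of $\mathrm{gr}^u(R)$ generated by all $\mathrm{in}_u(f)$, $f \in I$. Two weights $u,u' \in U_{\mathrm{loc}}$ are called equivalent if they have the same support, $\{i \mid u_i \neq 0\} = \{i \mid u'_i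 \neq 0\}$ (which holds if and only if $\mathrm{gr}^u(R) = \mathrm{gr}^{u'}(R)$ as subrings of $R$), and $\mathrm{in}_u(I) = \mathrm{in}_{u'}(I)$. The Gröbner cone $C_I[u] \subset U_{\mathrm{loc}}$ is the equivalence class of $u$. **Theorem.** For every ideal $I$ of $R$, the collection $\{\overline{C_I[u]} \mid u \in U_{\mathrm{loc}}\}$ of the closures in $\mathbb{R}^n$ of the Gröbner cones is a rational polyhedral fan. That is: the collection is finite; each of its members is a rational polyhedral cone (the solution set in $\mathbb{R}^n$ of finitely many inequalities $a\cdot x \le 0$ with $a\in\mathbb{Z}^n$); every nonempty face of a member (the set of points of the member at which some linear form attains its maximum over the member) is again a member; and the intersection of any two members is a nonempty face of both. -/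

import Mathlib

noncomputable section

namespace LocalGroebnerFan

/-! ## Rings of power series -/

/-- `f` converges absolutely on some polydisc around the origin of `ℂⁿ`. -/
def IsConvergent {n : ℕ} (f : MvPowerSeries (Fin n) ℂ) : Prop :=
  ∃ r : ℝ, 0 < r ∧
    Summable fun α : Fin n →₀ ℕ => ‖MvPowerSeries.coeff α f‖ * r ^ α.degree

theorem IsConvergent.summable_of_le {n : ℕ} {f : MvPowerSeries (Fin n) ℂ} {r s : ℝ}
    (hs : 0 < s) (hsr : s ≤ r)
    (h : Summable fun α : Fin n →₀ ℕ => ‖MvPowerSeries.coeff α f‖ * r ^ α.degree) :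
    Summable fun α : Fin n →₀ ℕ => ‖MvPowerSeries.coeff α f‖ * s ^ α.degree :=
  h.of_nonneg_of_le (fun _ => by positivity) (fun _ => by gcongr)

theorem IsConvergent.C {n : ℕ} (a : ℂ) :
    IsConvergent (MvPowerSeries.C a : MvPowerSeries (Fin n) ℂ) := by
  classical
  refine ⟨1, one_pos, summable_of_hasFiniteSupport ((Set.finite_singleton 0).subset ?_)⟩
  intro α hα
  by_contra h
  simp only [Set.mem_singleton_iff] at h
  simp [MvPowerSeries.coeff_C, h] at hα

theorem IsConvergent.add {n : ℕ} {f g : MvPowerSeries (Fin n) ℂ}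
    (hf : IsConvergent f) (hg : IsConvergent g) : IsConvergent (f + g) := by
  obtain ⟨r, hr, hf⟩ := hf
  obtain ⟨s, hs, hg⟩ := hg
  have hm : 0 < min r s := lt_min hr hs
  refine ⟨min r s, hm, ((summable_of_le hm (min_le_left _ _) hf).add
    (summable_of_le hm (min_le_right _ _) hg)).of_nonneg_of_le
    (fun _ => by positivity) (fun α => ?_)⟩
  rw [← add_mul, map_add]
  gcongr
  exact norm_add_le _ _

theorem IsConvergent.neg {n : ℕ} {f : MvPowerSeries (Fin n) ℂ}
    (hf : IsConvergent f) : IsConvergent (-f) := by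
  obtain ⟨r, hr, hf⟩ := hf
  exact ⟨r, hr, by simpa using hf⟩

theorem IsConvergent.mul {n : ℕ} {f g : MvPowerSeries (Fin n) ℂ}
    (hf : IsConvergent f) (hg : IsConvergent g) : IsConvergent (f * g) := by
  classical
  obtain ⟨r, hr, hf⟩ := hf
  obtain ⟨s, hs, hg⟩ := hg
  have hm : 0 < min r s := lt_min hr hs
  have hf' := summable_of_le hm (min_le_left _ _) hf
  have hg' := summable_of_le hm (min_le_right _ _) hg
  refine ⟨min r s, hm, (summable_sum_mul_antidiagonal_of_summable_mul
    (Summable.mul_of_nonneg hf' hg' (fun _ => by positivity)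
      (fun _ => by positivity))).of_nonneg_of_le (fun _ => by positivity) (fun α => ?_)⟩
  rw [MvPowerSeries.coeff_mul]
  calc _ ≤ (∑ p ∈ Finset.HasAntidiagonal.antidiagonal α, ‖MvPowerSeries.coeff p.1 f * MvPowerSeries.coeff p.2 g‖)
        * (min r s) ^ α.degree := by
        gcongr
        exact norm_sum_le _ _
    _ = _ := by
        rw [Finset.sum_mul]
        refine Finset.sum_congr rfl fun p hp => ?_
        rw [← Finset.HasAntidiagonal.mem_antidiagonal.1 hp, map_add, pow_add, norm_mul]
        ring

/-- The ring `𝒪₀ = ℂ{x₁, …, xₙ}` of convergent power series. -/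
def convergentPowerSeries (n : ℕ) : Subring (MvPowerSeries (Fin n) ℂ) where
  carrier := {f | IsConvergent f}
  mul_mem' := IsConvergent.mul
  one_mem' := by simpa using IsConvergent.C (n := n) 1
  add_mem' := IsConvergent.add
  zero_mem' := by simpa using IsConvergent.C (n := n) 0
  neg_mem' := IsConvergent.neg

/-! ## Weights and initial forms -/

/-- The local weight vectors: `u ∈ ℝⁿ` with `uᵢ ≤ 0` for all `i`. -/
def Uloc (n : ℕ) : Set (Fin n → ℝ) := {u | ∀ i, u i ≤ 0}

/-- The scalar product `u · α`. -/
def weight {n : ℕ} (u : Fin n → ℝ) (α : Fin n →₀ ℕ) : ℝ := ∑ i, u i * (α i : ℝ)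

theorem weight_add {n : ℕ} (u : Fin n → ℝ) (α β : Fin n →₀ ℕ) :
    weight u (α + β) = weight u α + weight u β := by
  simp [weight, mul_add, Finset.sum_add_distrib]

variable {k : Type*} [Field k]

/-- The set of exponents of `f`. -/
def exponents {n : ℕ} (f : MvPowerSeries (Fin n) k) : Set (Fin n →₀ ℕ) :=
  {α | MvPowerSeries.coeff α f ≠ 0}

open Classical in
/-- The initial form `in_u(f)`: the sum of the terms `c_α x^α` of `f` for which `u · α` is
maximal among the exponents of `f` (and `in_u(0) = 0`). -/
def initialForm {n : ℕ} (u : Fin n → ℝ) (f : MvPowerSeries (Fin n) k) :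
    MvPowerSeries (Fin n) k :=
  fun α => if ∀ β ∈ exponents f, weight u β ≤ weight u α then MvPowerSeries.coeff α f else 0

/-! ## Graded rings and initial ideals

`R` is a ring of power series, given with its inclusion `ι` into the formal power series ring. -/

/-- The associated graded ring `gr^u(R)`, realised as the subring of `R` formed by the finite sums
of `u`-homogeneous series, that is, by the series with only finitely many distinct `u`-weights. -/
def grRing {n : ℕ} {R : Type*} [CommRing R] (ι : R →+* MvPowerSeries (Fin n) k)
    (u : Fin n → ℝ) : Subring R where
  carrier := {f | (weight u '' exponents (ι f)).Finite}
  mul_mem' := by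
    classical
    intro f g hf hg
    refine (hf.add hg).subset ?_
    rintro _ ⟨α, hα, rfl⟩
    simp only [exponents, Set.mem_ofPred_eq, map_mul, MvPowerSeries.coeff_mul] at hα
    obtain ⟨p, hp, hne⟩ := Finset.exists_ne_zero_of_sum_ne_zero hα
    rw [← Finset.HasAntidiagonal.mem_antidiagonal.1 hp, weight_add]
    exact Set.add_mem_add ⟨_, left_ne_zero_of_mul hne, rfl⟩ ⟨_, right_ne_zero_of_mul hne, rfl⟩
  one_mem' := by
    classical
    refine (Set.finite_singleton (0 : ℝ)).subset ?_
    rintro _ ⟨α, hα, rfl⟩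
    simp only [exponents, Set.mem_ofPred_eq, map_one, MvPowerSeries.coeff_one] at hα
    have : α = 0 := by
      by_contra h
      simp [h] at hα
    simp [this, weight]
  add_mem' := by
    intro f g hf hg
    refine (hf.union hg).subset ?_
    rw [← Set.image_union]
    refine Set.image_mono ?_
    intro α hα
    by_contra h
    simp only [exponents, Set.mem_union, Set.mem_ofPred_eq, not_or, not_not] at h
    simp [exponents, h.1, h.2] at hα
  zero_mem' := by simp [exponents]
  neg_mem' := by
    intro f hf
    simpa [exponents] using hf

/-- The initial ideal `in_u(I)`: the ideal of `gr^u(R)` generated by all `in_u(f)`, `f ∈ I`. -/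
def initialIdeal {n : ℕ} {R : Type*} [CommRing R] (ι : R →+* MvPowerSeries (Fin n) k)
    (I : Ideal R) (u : Fin n → ℝ) : Ideal (grRing ι u) :=
  Ideal.span {g | ∃ f ∈ I, ι (g : R) = initialForm u (ι f)}

open Classical in
theorem coeff_initialForm {n : ℕ} (u : Fin n → ℝ) (f : MvPowerSeries (Fin n) k)
    (α : Fin n →₀ ℕ) : MvPowerSeries.coeff α (initialForm u f) =
      if ∀ β ∈ exponents f, weight u β ≤ weight u α then MvPowerSeries.coeff α f else 0 :=
  rfl

theorem finite_weight_initialForm {n : ℕ} (u : Fin n → ℝ) (f : MvPowerSeries (Fin n) k) :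
    (weight u '' exponents (initialForm u f)).Finite := by
  refine Set.Subsingleton.finite ?_
  have key : ∀ α ∈ exponents (initialForm u f),
      α ∈ exponents f ∧ ∀ β ∈ exponents f, weight u β ≤ weight u α := by
    intro α hα
    change MvPowerSeries.coeff α (initialForm u f) ≠ 0 at hα
    rw [coeff_initialForm] at hα
    by_cases h : ∀ β ∈ exponents f, weight u β ≤ weight u α
    · rw [if_pos h] at hα
      exact ⟨hα, h⟩
    · rw [if_neg h] at hα
      exact absurd rfl hα
  rintro _ ⟨α, hα, rfl⟩ _ ⟨β, hβ, rfl⟩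
  exact le_antisymm ((key β hβ).2 α (key α hα).1) ((key α hα).2 β (key β hβ).1)

/-- Initial forms of formal power series lie in the graded ring. -/
theorem exists_grRing_eq_initialForm {n : ℕ} (u : Fin n → ℝ) (f : MvPowerSeries (Fin n) k) :
    ∃ g : grRing (RingHom.id (MvPowerSeries (Fin n) k)) u,
      (g : MvPowerSeries (Fin n) k) = initialForm u f :=
  ⟨⟨initialForm u f, finite_weight_initialForm u f⟩, rfl⟩

theorem IsConvergent.initialForm {n : ℕ} (u : Fin n → ℝ) {f : MvPowerSeries (Fin n) ℂ}
    (hf : IsConvergent f) : IsConvergent (initialForm u f) := by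
  obtain ⟨r, hr, hf⟩ := hf
  refine ⟨r, hr, hf.of_nonneg_of_le (fun _ => by positivity) (fun α => ?_)⟩
  gcongr
  rw [coeff_initialForm]
  split_ifs <;> simp

/-- Initial forms of convergent power series lie in the graded ring. -/
theorem exists_grRing_eq_initialForm_convergent {n : ℕ} (u : Fin n → ℝ)
    (f : convergentPowerSeries n) :
    ∃ g : grRing (convergentPowerSeries n).subtype u,
      (convergentPowerSeries n).subtype g = initialForm u (f : MvPowerSeries (Fin n) ℂ) :=
  ⟨⟨⟨initialForm u (f : MvPowerSeries (Fin n) ℂ), IsConvergent.initialForm u f.2⟩,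
    finite_weight_initialForm u _⟩, rfl⟩

/-! Two local weights have the same graded ring if and only if they have the same support. -/

theorem grRing_le {n : ℕ} {R : Type*} [CommRing R] (ι : R →+* MvPowerSeries (Fin n) k)
    {u u' : Fin n → ℝ} (hu : u ∈ Uloc n) (h : Function.support u' ⊆ Function.support u) :
    grRing ι u ≤ grRing ι u' := by
  classical
  intro f hf
  have hf : (weight u '' exponents (ι f)).Finite := hf
  obtain ⟨B, hB⟩ := hf.bddBelow
  let ρ : (Fin n →₀ ℕ) → Fin n → ℕ := fun α i => if u i = 0 then 0 else α i
  have hfin : (ρ '' exponents (ι f)).Finite := by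
    refine (Set.finite_Iic (fun i => ⌊B / u i⌋₊)).subset ?_
    rintro _ ⟨α, hα, rfl⟩ i
    by_cases hi : u i = 0
    · simp [ρ, hi]
    · have hneg : u i < 0 := lt_of_le_of_ne (hu i) hi
      have h1 : B ≤ weight u α := hB ⟨α, hα, rfl⟩
      have h2 : weight u α ≤ u i * (α i : ℝ) := by
        have h4 : ∀ j ∈ Finset.univ, 0 ≤ -(u j * (α j : ℝ)) := fun j _ => by
          have := mul_nonneg (neg_nonneg.2 (hu j)) (Nat.cast_nonneg (α := ℝ) (α j))
          linarith
        have h3 := Finset.single_le_sum h4 (Finset.mem_univ i)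
        rw [Finset.sum_neg_distrib] at h3
        simp only [weight]
        linarith
      simp only [ρ, hi, if_false]
      apply Nat.le_floor
      rw [le_div_iff_of_neg hneg]
      linarith
  refine (hfin.image (fun a : Fin n → ℕ => ∑ i, u' i * (a i : ℝ))).subset ?_
  rintro _ ⟨α, hα, rfl⟩
  refine ⟨ρ α, ⟨α, hα, rfl⟩, Finset.sum_congr rfl fun i _ => ?_⟩
  by_cases hi : u i = 0
  · have : u' i = 0 := by
      by_contra hne
      exact h hne hi
    simp [this]
  · simp [ρ, hi]

/-- The geometric series `1 + xᵢ + xᵢ² + ⋯`. -/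
def geom {n : ℕ} (i : Fin n) : MvPowerSeries (Fin n) k :=
  open Classical in fun α => if α ∈ Set.range (Finsupp.single i) then 1 else 0

theorem exponents_geom {n : ℕ} (i : Fin n) :
    exponents (geom i : MvPowerSeries (Fin n) k) = Set.range (Finsupp.single i) := by
  ext α
  simp only [exponents, geom, Set.mem_ofPred_eq, MvPowerSeries.coeff_apply]
  split_ifs with h <;> simp [h]

theorem weight_single {n : ℕ} (u : Fin n → ℝ) (i : Fin n) (m : ℕ) :
    weight u (Finsupp.single i m) = u i * m := by
  classical
  rw [weight, Finset.sum_eq_single i]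
  · simp
  · intro j _ hj
    simp [hj.symm]
  · simp

theorem isConvergent_geom {n : ℕ} (i : Fin n) :
    IsConvergent (geom i : MvPowerSeries (Fin n) ℂ) := by
  refine ⟨1 / 2, by norm_num, ?_⟩
  rw [← (Finsupp.single_injective i).summable_iff]
  · refine summable_geometric_two.congr fun m => ?_
    simp [geom, MvPowerSeries.coeff_apply]
  · intro α hα
    simp [geom, MvPowerSeries.coeff_apply, hα]

theorem support_subset_of_grRing_le {n : ℕ} {R : Type*} [CommRing R]
    (ι : R →+* MvPowerSeries (Fin n) k) (hι : ∀ i, ∃ f, ι f = geom i)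
    {u u' : Fin n → ℝ} (h : grRing ι u ≤ grRing ι u') :
    Function.support u' ⊆ Function.support u := by
  intro i hi hui
  obtain ⟨f, hf⟩ := hι i
  have h1 : f ∈ grRing ι u := by
    change (weight u '' exponents (ι f)).Finite
    rw [hf, exponents_geom]
    refine (Set.finite_singleton (0 : ℝ)).subset ?_
    rintro _ ⟨_, ⟨m, rfl⟩, rfl⟩
    simp [weight_single, hui]
  have h2 : (weight u' '' exponents (ι f)).Finite := h h1
  rw [hf, exponents_geom, ← Set.range_comp] at h2
  refine Set.infinite_range_of_injective (f := weight u' ∘ Finsupp.single i) ?_ h2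
  intro a b hab
  simp only [Function.comp_apply, weight_single] at hab
  exact_mod_cast mul_left_cancel₀ hi hab

theorem grRing_eq_iff {n : ℕ} {u u' : Fin n → ℝ} (hu : u ∈ Uloc n) (hu' : u' ∈ Uloc n) :
    grRing (RingHom.id (MvPowerSeries (Fin n) k)) u = grRing (RingHom.id _) u' ↔
      Function.support u = Function.support u' :=
  ⟨fun h => (support_subset_of_grRing_le _ (fun i => ⟨geom i, rfl⟩) h.ge).antisymm
      (support_subset_of_grRing_le _ (fun i => ⟨geom i, rfl⟩) h.le),
    fun h => (grRing_le _ hu h.ge).antisymm (grRing_le _ hu' h.le)⟩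

theorem grRing_convergent_eq_iff {n : ℕ} {u u' : Fin n → ℝ}
    (hu : u ∈ Uloc n) (hu' : u' ∈ Uloc n) :
    grRing (convergentPowerSeries n).subtype u = grRing (convergentPowerSeries n).subtype u' ↔
      Function.support u = Function.support u' :=
  ⟨fun h => (support_subset_of_grRing_le _ (fun i => ⟨⟨geom i, isConvergent_geom i⟩, rfl⟩)
        h.ge).antisymm
      (support_subset_of_grRing_le _ (fun i => ⟨⟨geom i, isConvergent_geom i⟩, rfl⟩) h.le),
    fun h => (grRing_le _ hu h.ge).antisymm (grRing_le _ hu' h.le)⟩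

/-! ## Gröbner cones and the closed Gröbner fan -/

/-- Two weights are equivalent if they have the same support and the same initial ideal. (Weights
in `Uloc n` have the same support if and only if they have the same graded ring; the initial ideals are compared as subsets
of `R`.) -/
def WeightEquiv {n : ℕ} {R : Type*} [CommRing R] (ι : R →+* MvPowerSeries (Fin n) k)
    (I : Ideal R) (u u' : Fin n → ℝ) : Prop :=
  Function.support u = Function.support u' ∧
    ((↑) '' (initialIdeal ι I u : Set (grRing ι u)) : Set R) =
      (↑) '' (initialIdeal ι I u' : Set (grRing ι u'))

/-- The Gröbner cone `C_I[u]`. -/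
def groebnerCone {n : ℕ} {R : Type*} [CommRing R] (ι : R →+* MvPowerSeries (Fin n) k)
    (I : Ideal R) (u : Fin n → ℝ) : Set (Fin n → ℝ) :=
  {u' ∈ Uloc n | WeightEquiv ι I u u'}

/-- The closed Gröbner fan: the collection of the closures of the Gröbner cones. -/
def closedGroebnerFan {n : ℕ} {R : Type*} [CommRing R] (ι : R →+* MvPowerSeries (Fin n) k)
    (I : Ideal R) : Set (Set (Fin n → ℝ)) :=
  (fun u => closure (groebnerCone ι I u)) '' Uloc n

/-! ## Rational polyhedral fans -/

/-- A rational polyhedral cone in `ℝⁿ`: the solution set of finitely many homogeneous linear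
inequalities with integer coefficients. -/
def IsRationalPolyhedralCone {n : ℕ} (P : Set (Fin n → ℝ)) : Prop :=
  ∃ S : Finset (Fin n → ℤ), P = {x | ∀ a ∈ S, ∑ i, (a i : ℝ) * x i ≤ 0}

/-- `F` is a (nonempty) face of `P`: the set of all points of `P` at which some linear form attains
its maximum over `P`. -/
def IsFace {n : ℕ} (P F : Set (Fin n → ℝ)) : Prop :=
  F.Nonempty ∧ IsExposed ℝ P F

/-- A rational polyhedral fan: a finite collection of rational polyhedral cones which contains
every face of each of its cones, and in which any two cones meet in a common face. -/
structure IsRationalPolyhedralFan {n : ℕ} (𝓕 : Set (Set (Fin n → ℝ))) : Prop where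
  finite : 𝓕.Finite
  isRationalPolyhedralCone : ∀ P ∈ 𝓕, IsRationalPolyhedralCone P
  face_mem : ∀ P ∈ 𝓕, ∀ F, IsFace P F → F ∈ 𝓕
  inter_isFace : ∀ P ∈ 𝓕, ∀ Q ∈ 𝓕, IsFace P (P ∩ Q) ∧ IsFace Q (P ∩ Q)

end LocalGroebnerFan

end

noncomputable section

namespace LocalGroebnerFan

/-! ## Monomial orders -/

/-! The plan is to show that each Gröbner cone is a relatively open face of one of finitely many
rational polyhedral cones, and that all faces of those cones occur.

Fix a local monomial order `o`. Division with remainder yields a reduced basis: for each minimal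
leading exponent `α` of `I` an element `g α` of `I` equal to `x^α` plus terms whose exponents are
not leading exponents. If the order refines `u`, then among weights with the support of `u`,
`in_u(I)` is determined by the initial forms of the `g α` (`IsReducedBasis.weightEquiv_iff`). By
Dickson's lemma only the finitely many minimal exponents of each `g α` matter, because `u ≤ 0` and
equality of supports controls the remaining ties. Hence for every `w` satisfying finitely many
inequalities attached to `g`, the class of `w` is given by which of them are strict at `w`
(`IsReducedBasis.groebnerCone_eq`). The fan axioms then follow from polyhedral geometry alone
(`isRationalPolyhedralFan_of_openCone`).

Only finitely many systems of inequalities arise, because `I` has finitely many sets of leading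
exponents (`Admissible.finite_range_leadSet`). This is a compactness argument: infinitely many such
sets would give a sequence of orders with a limit along an ultrafilter, and a reduced basis for the
limit, being tested by finitely many comparisons, would force many members of the sequence to share
one set. Requiring orders to be approximable by positive weights on finite sets is what makes them
closed under such limits.

Both rings are treated through `Admissible`. Its one analytic clause, that the division equation can
be solved inside the ring, is proved for convergent series by replacing the order with a positive
weight `L` on finitely many comparisons and estimating at the point `exp (-T Lᵢ)` for large `T`,
where the tails of the divisors are negligible (`isConvergent_of_division_solution`). -/

theorem weight_mono {n : ℕ} {L : Fin n → ℝ} (hL : ∀ i, 0 ≤ L i) {α β : Fin n →₀ ℕ}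
    (h : α ≤ β) : weight L α ≤ weight L β :=
  Finset.sum_le_sum fun i _ => mul_le_mul_of_nonneg_left (Nat.cast_le.2 (h i)) (hL i)

theorem weight_anti {n : ℕ} {u : Fin n → ℝ} (hu : u ∈ Uloc n) {α β : Fin n →₀ ℕ}
    (h : α ≤ β) : weight u β ≤ weight u α :=
  Finset.sum_le_sum fun i _ => mul_le_mul_of_nonpos_left (Nat.cast_le.2 (h i)) (hu i)

/-- The minimal elements of a set of exponents. -/
def minimals {n : ℕ} (A : Set (Fin n →₀ ℕ)) : Set (Fin n →₀ ℕ) := {α | Minimal (· ∈ A) α}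

theorem finite_minimals {n : ℕ} (A : Set (Fin n →₀ ℕ)) : (minimals A).Finite :=
  WellQuasiOrderedLE.finite_of_isAntichain (setOfPred_minimal_antichain (· ∈ A))

theorem exists_minimals_le {n : ℕ} {A : Set (Fin n →₀ ℕ)} {α : Fin n →₀ ℕ} (h : α ∈ A) :
    ∃ γ ∈ minimals A, γ ≤ α := by
  obtain ⟨γ, h1, h2⟩ := exists_minimal_le_of_wellFoundedLT (· ∈ A) α h
  exact ⟨γ, h2, h1⟩

/-- A local monomial order, written so that leading exponents are *least* elements: a total
relation on exponents that agrees on every finite set with the order given by some positive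
weight vector. -/
structure MonOrd (n : ℕ) where
  lt : (Fin n →₀ ℕ) → (Fin n →₀ ℕ) → Prop
  total : ∀ α β, α ≠ β → lt α β ∨ lt β α
  approx : ∀ T : Finset ((Fin n →₀ ℕ) × (Fin n →₀ ℕ)), (∀ p ∈ T, lt p.1 p.2) →
    ∃ L : Fin n → ℝ, (∀ i, 0 < L i) ∧ ∀ p ∈ T, weight L p.1 < weight L p.2

namespace MonOrd

variable {n : ℕ} (o : MonOrd n) {α β γ δ : Fin n →₀ ℕ}

theorem not_lt_of_le (h : β ≤ α) : ¬ o.lt α β := fun hl => by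
  obtain ⟨L, hL, hT⟩ := o.approx {(α, β)} (by simpa using hl)
  have := hT (α, β) (by simp)
  exact absurd (weight_mono (fun i => (hL i).le) h) (not_le.2 this)

theorem irrefl : ¬ o.lt α α := o.not_lt_of_le le_rfl

theorem asymm (h : o.lt α β) : ¬ o.lt β α := fun h' => by
  classical
  obtain ⟨L, hL, hT⟩ := o.approx {(α, β), (β, α)} (by simp [h, h'])
  have h1 := hT (α, β) (by simp)
  have h2 := hT (β, α) (by simp)
  exact lt_asymm h1 h2

theorem trans (h : o.lt α β) (h' : o.lt β γ) : o.lt α γ := by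
  classical
  by_contra hn
  rcases eq_or_ne α γ with rfl | hne
  · exact o.asymm h h'
  have h3 := (o.total _ _ hne).resolve_left hn
  obtain ⟨L, hL, hT⟩ := o.approx {(α, β), (β, γ), (γ, α)} (by simp [h, h', h3])
  have h1 := hT (α, β) (by simp)
  have h2 := hT (β, γ) (by simp)
  have h3 := hT (γ, α) (by simp)
  exact lt_asymm (h1.trans h2) h3

theorem add_lt (h : o.lt α β) (δ : Fin n →₀ ℕ) : o.lt (δ + α) (δ + β) := by
  classical
  have hne : δ + α ≠ δ + β := fun he => by
    rw [add_left_cancel he] at h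
    exact o.irrefl h
  by_contra hn
  have h3 := (o.total _ _ hne).resolve_left hn
  obtain ⟨L, hL, hT⟩ := o.approx {(α, β), (δ + β, δ + α)} (by simp [h, h3])
  have h1 := hT (α, β) (by simp)
  have h2 := hT (δ + β, δ + α) (by simp)
  simp only [weight_add] at h2
  linarith

theorem lt_of_le_of_ne (h : α ≤ β) (hne : α ≠ β) : o.lt α β :=
  (o.total _ _ hne).resolve_right (o.not_lt_of_le h)

theorem wf : WellFounded o.lt := by
  rw [wellFounded_iff_isEmpty_descending_chain]
  refine ⟨fun ⟨f, hf⟩ => ?_⟩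
  have hlt : ∀ m d : ℕ, o.lt (f (m + d + 1)) (f m) := by
    intro m d
    induction d with
    | zero => exact hf m
    | succ d ih => exact o.trans (hf _) ih
  -- Dickson's lemma: an infinite sequence of exponents has an earlier term dividing a later one,
  -- which a descending chain forbids.
  obtain ⟨a, b, hab, hle⟩ := wellQuasiOrdered_le f
  obtain ⟨d, rfl⟩ := Nat.exists_eq_add_of_lt hab
  exact o.not_lt_of_le hle (hlt a d)

theorem exists_least {A : Set (Fin n →₀ ℕ)} (hA : A.Nonempty) :
    ∃ γ ∈ A, ∀ β ∈ A, β ≠ γ → o.lt γ β :=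
  ⟨o.wf.min A hA, o.wf.min_mem A hA, fun _ hβ hne =>
    (o.total _ _ hne).resolve_left (o.wf.not_lt_min A hβ)⟩

/-- The order that compares `u`-weights first and breaks ties with `o`. -/
def refine {u : Fin n → ℝ} (hu : u ∈ Uloc n) : MonOrd n where
  lt α β := weight u β < weight u α ∨ weight u β = weight u α ∧ o.lt α β
  total α β hne := by
    rcases lt_trichotomy (weight u α) (weight u β) with h | h | h
    · exact Or.inr (Or.inl h)
    · exact (o.total α β hne).imp (fun h' => Or.inr ⟨h.symm, h'⟩) (fun h' => Or.inr ⟨h, h'⟩)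
    · exact Or.inl (Or.inl h)
  approx T hT := by
    classical
    obtain ⟨L, hL, hLT⟩ := o.approx (T.filter fun p => o.lt p.1 p.2)
      (fun p hp => (Finset.mem_filter.1 hp).2)
    -- The approximating vector is `L - M u`. For large `M` the `u`-weights dominate, and ties are
    -- left to `L`. It is positive because `u ≤ 0`.
    have key : ∀ p ∈ T, ∀ᶠ M : ℝ in Filter.atTop,
        weight L p.1 - weight L p.2 < M * (weight u p.1 - weight u p.2) := by
      intro p hp
      rcases hT p hp with h | ⟨h, h'⟩
      · exact (Filter.tendsto_id.atTop_mul_const (sub_pos.2 h)).eventually_gt_atTop _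
      · refine Filter.Eventually.of_forall fun M => ?_
        have := hLT p (Finset.mem_filter.2 ⟨hp, h'⟩)
        rw [h]
        linarith
    obtain ⟨M, hM, hM0⟩ := (((Finset.eventually_all T).2 key).and
      (Filter.eventually_ge_atTop 0)).exists
    have hw : ∀ α, weight (fun i => L i - M * u i) α = weight L α - M * weight u α := by
      intro α
      simp only [weight, sub_mul, Finset.sum_sub_distrib, Finset.mul_sum, mul_assoc]
    refine ⟨fun i => L i - M * u i, fun i => ?_, fun p hp => ?_⟩
    · have := mul_nonneg hM0 (neg_nonneg.2 (hu i))
      have := hL i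
      linarith
    · have := hM p hp
      rw [hw, hw]
      linarith

/-- The limit of a sequence of orders along a nonprincipal ultrafilter. -/
def limit (s : ℕ → MonOrd n) : MonOrd n where
  lt α β := ∀ᶠ m in Filter.hyperfilter ℕ, (s m).lt α β
  total α β hne := Ultrafilter.eventually_or.1 (Filter.Eventually.of_forall
    fun m => (s m).total α β hne)
  approx T hT := by
    -- Finitely many comparisons hold simultaneously in a single order of the sequence, whose
    -- approximating vector serves.
    obtain ⟨m, hm⟩ := ((Finset.eventually_all T).2 hT).exists
    exact (s m).approx T hm

/-- A positive weight vector with entries linearly independent over the integers separates all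
exponents. The powers of a transcendental number are such entries: equal weights would make it a
root of the integer polynomial `p`. -/
theorem nonempty : Nonempty (MonOrd n) := by
  set x := liouvilleNumber ((2 : ℕ) : ℝ) with hx
  have htr : Transcendental ℤ x := transcendental_liouvilleNumber le_rfl
  have hpos : 0 < x := 
    (LiouvilleNumber.summable (by norm_num)).tsum_pos (fun _ => by positivity) 0 (by positivity)
  let θ : Fin n → ℝ := fun i => x ^ (i : ℕ)
  refine ⟨⟨fun α β => weight θ α < weight θ β, fun α β hne => lt_or_gt_of_ne fun h => hne ?_,
    fun T hT => ⟨θ, fun i => pow_pos hpos _, hT⟩⟩⟩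
  let p : Polynomial ℤ := ∑ i : Fin n, Polynomial.monomial (i : ℕ) ((α i : ℤ) - (β i : ℤ))
  have hp : Polynomial.aeval x p = 0 := by
    simp only [weight, θ] at h
    simp only [p, map_sum, Polynomial.aeval_monomial]
    simp only [algebraMap_int_eq, eq_intCast, Int.cast_sub, Int.cast_natCast,
      mul_comm _ (x ^ _), mul_sub, Finset.sum_sub_distrib]
    rw [h, sub_self]
  have hp0 : p = 0 := (transcendental_iff.1 htr) p hp
  ext i
  have := congrArg (fun q => Polynomial.coeff q (i : ℕ)) hp0
  simp only [p, Polynomial.finsetSum_coeff, Polynomial.coeff_monomial, Polynomial.coeff_zero,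
    Fin.val_inj] at this
  simp at this
  omega

end MonOrd

/-! ## Division -/

section Division

variable {k : Type*} [Field k] {n : ℕ}

open MvPowerSeries

open Classical in
/-- The sum of the terms of `f` with exponent in `S`. -/
def restrict (S : Set (Fin n →₀ ℕ)) (f : MvPowerSeries (Fin n) k) : MvPowerSeries (Fin n) k :=
  fun α => if α ∈ S then coeff α f else 0

open Classical in
theorem coeff_restrict (S : Set (Fin n →₀ ℕ)) (f : MvPowerSeries (Fin n) k) (α : Fin n →₀ ℕ) :
    coeff α (restrict S f) = if α ∈ S then coeff α f else 0 := rfl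

theorem mem_exponents {f : MvPowerSeries (Fin n) k} {α : Fin n →₀ ℕ} :
    α ∈ exponents f ↔ coeff α f ≠ 0 := Iff.rfl

theorem mem_exponents_restrict {S : Set (Fin n →₀ ℕ)} {f : MvPowerSeries (Fin n) k}
    {α : Fin n →₀ ℕ} : α ∈ exponents (restrict S f) ↔ α ∈ S ∧ α ∈ exponents f := by
  rw [mem_exponents, coeff_restrict, mem_exponents]
  split_ifs with h <;> simp [h]

theorem exponents_nonempty {f : MvPowerSeries (Fin n) k} (hf : f ≠ 0) :
    (exponents f).Nonempty := by
  by_contra h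
  refine hf (MvPowerSeries.ext fun α => ?_)
  by_contra hα
  exact h ⟨α, hα⟩

theorem exponents_mul {f g : MvPowerSeries (Fin n) k} {γ : Fin n →₀ ℕ}
    (h : γ ∈ exponents (f * g)) : ∃ α ∈ exponents f, ∃ β ∈ exponents g, α + β = γ := by
  classical
  rw [mem_exponents, coeff_mul] at h
  obtain ⟨p, hp, hne⟩ := Finset.exists_ne_zero_of_sum_ne_zero h
  exact ⟨p.1, left_ne_zero_of_mul hne, p.2, right_ne_zero_of_mul hne,
    Finset.HasAntidiagonal.mem_antidiagonal.1 hp⟩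

theorem exponents_sub {f g : MvPowerSeries (Fin n) k} {γ : Fin n →₀ ℕ}
    (h : γ ∈ exponents (f - g)) : γ ∈ exponents f ∨ γ ∈ exponents g := by
  by_contra hn
  simp only [mem_exponents, not_or, not_not] at hn
  simp [mem_exponents, hn.1, hn.2] at h

/-- The series `∑ c_{β + α} x^β`. -/
def shift (α : Fin n →₀ ℕ) (f : MvPowerSeries (Fin n) k) : MvPowerSeries (Fin n) k :=
  fun β => coeff (β + α) f

theorem coeff_shift (α β : Fin n →₀ ℕ) (f : MvPowerSeries (Fin n) k) :
    coeff β (shift α f) = coeff (β + α) f := rfl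

open Classical in
theorem coeff_shift_restrict_mul (α γ : Fin n →₀ ℕ) (D : Set (Fin n →₀ ℕ))
    (h t : MvPowerSeries (Fin n) k) :
    coeff γ (shift α (restrict D h) * t) =
      ∑ p ∈ Finset.HasAntidiagonal.antidiagonal γ,
        (if p.1 + α ∈ D then coeff (p.1 + α) h else 0) * coeff p.2 t := by
  rw [coeff_mul]
  rfl

/-- The coefficients of the solution of the division equation depend only on the coefficients at
smaller exponents. -/
theorem exists_division_solution (o : MonOrd n) (B : Finset (Fin n →₀ ℕ))
    (D : (Fin n →₀ ℕ) → Set (Fin n →₀ ℕ)) (t : (Fin n →₀ ℕ) → MvPowerSeries (Fin n) k)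
    (f : MvPowerSeries (Fin n) k) (ht : ∀ α ∈ B, ∀ β ∈ exponents (t α), o.lt α β) :
    ∃ h, h + ∑ α ∈ B, shift α (restrict (D α) h) * t α = f := by
  classical
  -- The equation is solved for the coefficient at `γ` by well-founded recursion. The terms dropped
  -- by the `else 0` vanish anyway, since `t α` has only exponents above `α`.
  let F : ∀ γ : Fin n →₀ ℕ, (∀ δ, o.lt δ γ → k) → k := fun γ IH => coeff γ f -
    ∑ α ∈ B, ∑ p ∈ Finset.HasAntidiagonal.antidiagonal γ,
      if hp : o.lt (p.1 + α) γ then (if p.1 + α ∈ D α then IH _ hp else 0) * coeff p.2 (t α)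
      else 0
  let h : MvPowerSeries (Fin n) k := fun γ => o.wf.fix F γ
  refine ⟨h, MvPowerSeries.ext fun γ => ?_⟩
  have h1 : coeff γ h = F γ (fun δ _ => coeff δ h) := o.wf.fix_eq F γ
  rw [map_add, h1, map_sum, sub_add_eq_add_sub, sub_eq_iff_eq_add]
  congr 1
  refine Finset.sum_congr rfl fun α hα => ?_
  rw [coeff_shift_restrict_mul]
  refine Finset.sum_congr rfl fun p hp => ?_
  by_cases hlt : o.lt (p.1 + α) γ
  · simp only [dif_pos hlt]
  · have : coeff p.2 (t α) = 0 := by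
      by_contra hne
      have h2 := o.add_lt (ht α hα _ hne) p.1
      rw [Finset.HasAntidiagonal.mem_antidiagonal.1 hp] at h2
      exact hlt h2
    simp [this]

/-- The correction terms only involve exponents strictly above those of `h`. At the least exponent
of `h` they vanish, so this exponent also occurs in `f`. -/
theorem division_solution_bound (o : MonOrd n) (B : Finset (Fin n →₀ ℕ))
    (D : (Fin n →₀ ℕ) → Set (Fin n →₀ ℕ)) (t : (Fin n →₀ ℕ) → MvPowerSeries (Fin n) k)
    {f h : MvPowerSeries (Fin n) k} (ht : ∀ α ∈ B, ∀ β ∈ exponents (t α), o.lt α β)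
    (hf : h + ∑ α ∈ B, shift α (restrict (D α) h) * t α = f) {γ₀ : Fin n →₀ ℕ}
    (hγ₀ : ∀ β ∈ exponents f, ¬ o.lt β γ₀) : ∀ β ∈ exponents h, ¬ o.lt β γ₀ := by
  classical
  intro β hβ hlt
  obtain ⟨γ, hγ, hmin⟩ := o.exists_least (A := exponents h) ⟨β, hβ⟩
  have hγlt : o.lt γ γ₀ := by
    rcases eq_or_ne β γ with rfl | hne
    · exact hlt
    · exact o.trans (hmin β hβ hne) hlt
  refine hγ₀ γ ?_ hγlt
  rw [mem_exponents, ← hf, map_add, map_sum, Finset.sum_eq_zero, add_zero]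
  · exact hγ
  intro α hα
  rw [coeff_shift_restrict_mul]
  refine Finset.sum_eq_zero fun p hp => ?_
  by_contra hne
  have h1 := left_ne_zero_of_mul hne
  have h2 := o.add_lt (ht α hα _ (right_ne_zero_of_mul hne)) p.1
  rw [Finset.HasAntidiagonal.mem_antidiagonal.1 hp] at h2
  split_ifs at h1 with h3
  · refine o.asymm h2 (hmin _ h1 fun he => ?_)
    rw [he] at h2
    exact o.irrefl h2
  · exact h1 rfl

/-- `γ` is the leading exponent of `f`. -/
def IsLead (o : MonOrd n) (f : MvPowerSeries (Fin n) k) (γ : Fin n →₀ ℕ) : Prop :=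
  γ ∈ exponents f ∧ ∀ β ∈ exponents f, β ≠ γ → o.lt γ β

theorem exists_isLead (o : MonOrd n) {f : MvPowerSeries (Fin n) k} (hf : f ≠ 0) :
    ∃ γ, IsLead o f γ := by
  obtain ⟨γ, h1, h2⟩ := o.exists_least (exponents_nonempty hf)
  exact ⟨γ, h1, h2⟩

theorem IsLead.not_lt {o : MonOrd n} {f : MvPowerSeries (Fin n) k} {γ : Fin n →₀ ℕ}
    (h : IsLead o f γ) : ∀ β ∈ exponents f, ¬ o.lt β γ := fun β hβ hlt => by
  rcases eq_or_ne β γ with rfl | hne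
  · exact o.irrefl hlt
  · exact o.asymm hlt (h.2 β hβ hne)

theorem exponents_monomial_mul {α γ : Fin n →₀ ℕ} {c : k} (hc : c ≠ 0)
    {f : MvPowerSeries (Fin n) k} :
    γ ∈ exponents (monomial α c * f) ↔ ∃ β ∈ exponents f, α + β = γ := by
  classical
  constructor
  · intro h
    obtain ⟨a, ha, b, hb, rfl⟩ := exponents_mul h
    rw [mem_exponents, coeff_monomial] at ha
    split_ifs at ha with h
    · exact ⟨b, hb, by rw [h]⟩
    · exact absurd rfl ha
  · rintro ⟨β, hβ, rfl⟩
    rw [mem_exponents, coeff_add_monomial_mul]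
    exact mul_ne_zero hc hβ

theorem IsLead.monomial_mul {o : MonOrd n} {f : MvPowerSeries (Fin n) k} {γ : Fin n →₀ ℕ}
    (h : IsLead o f γ) (δ : Fin n →₀ ℕ) {c : k} (hc : c ≠ 0) :
    IsLead o (monomial δ c * f) (δ + γ) := by
  refine ⟨(exponents_monomial_mul hc).2 ⟨γ, h.1, rfl⟩, fun β hβ hne => ?_⟩
  obtain ⟨b, hb, rfl⟩ := (exponents_monomial_mul hc).1 hβ
  exact o.add_lt (h.2 b hb fun he => hne (by rw [he])) δ

/-! ### Division with remainder in an admissible ring. -/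

variable {R : Type*} [CommRing R]

/-- The properties of the inclusion of a ring of power series that are used for division: `R` is
closed under selecting terms, contains the monomials, is closed under division by monomials and
under solving the division equation. -/
structure Admissible (ι : R →+* MvPowerSeries (Fin n) k) : Prop where
  injective : Function.Injective ι
  exists_restrict : ∀ (f : R) (S : Set (Fin n →₀ ℕ)), ∃ f', ι f' = restrict S (ι f)
  exists_monomial : ∀ (α : Fin n →₀ ℕ) (c : k), ∃ f, ι f = monomial α c
  exists_shift : ∀ (f : R) (α : Fin n →₀ ℕ), ∃ f', ι f' = shift α (ι f)
  exists_solution : ∀ (o : MonOrd n) (B : Finset (Fin n →₀ ℕ))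
    (D : (Fin n →₀ ℕ) → Set (Fin n →₀ ℕ)) (t : (Fin n →₀ ℕ) → R) (f : R)
    (h : MvPowerSeries (Fin n) k), (∀ α ∈ B, ∀ β ∈ exponents (ι (t α)), o.lt α β) →
    h + ∑ α ∈ B, shift α (restrict (D α) h) * ι (t α) = ι f → ∃ h', ι h' = h

theorem admissible_id : Admissible (RingHom.id (MvPowerSeries (Fin n) k)) :=
  ⟨Function.injective_id, fun _ _ => ⟨_, rfl⟩, fun _ _ => ⟨_, rfl⟩, fun _ _ => ⟨_, rfl⟩,
    fun _ _ _ _ _ _ _ _ => ⟨_, rfl⟩⟩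

variable {ι : R →+* MvPowerSeries (Fin n) k}

/-- With `g α = x^α + t α`, one series `h` encodes all quotients and the remainder: a term of `h`
divisible by some `x^α` is assigned to one such `α`, and the other terms form `r`. Division then
becomes the equation solved by `exists_division_solution`. The bound `γ₀` records that no
cancellation from below is used. -/
theorem Admissible.division (hι : Admissible ι) (o : MonOrd n) (B : Finset (Fin n →₀ ℕ))
    (g : (Fin n →₀ ℕ) → R)
    (hg : ∀ α ∈ B, IsLead o (ι (g α)) α ∧ coeff α (ι (g α)) = 1) (f : R) {γ₀ : Fin n →₀ ℕ}
    (hγ₀ : ∀ β ∈ exponents (ι f), ¬ o.lt β γ₀) :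
    ∃ (q : (Fin n →₀ ℕ) → R) (r : R), f = ∑ α ∈ B, q α * g α + r ∧
      (∀ β ∈ exponents (ι r), (∀ α ∈ B, ¬ α ≤ β) ∧ ¬ o.lt β γ₀) ∧
      ∀ α ∈ B, ∀ β ∈ exponents (ι (q α)), ¬ o.lt (β + α) γ₀ := by
  classical
  choose m hm using fun α => hι.exists_monomial α 1
  let t : (Fin n →₀ ℕ) → R := fun α => g α - m α
  have ht : ∀ α ∈ B, ∀ β ∈ exponents (ι (t α)), o.lt α β := by
    intro α hα β hβ
    simp only [t, map_sub, hm] at hβ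
    rw [mem_exponents, map_sub, coeff_monomial] at hβ
    split_ifs at hβ with h
    · rw [h, (hg α hα).2, sub_self] at hβ
      exact absurd rfl hβ
    · rw [sub_zero] at hβ
      exact (hg α hα).1.2 β hβ h
  -- The choice of a divisor makes the sets `D α` disjoint. The default `0` is harmless, as `D α`
  -- also demands that a divisor exist.
  let φ : (Fin n →₀ ℕ) → (Fin n →₀ ℕ) := fun δ => if h : ∃ α ∈ B, α ≤ δ then h.choose else 0
  have hφ : ∀ δ, (∃ α ∈ B, α ≤ δ) → φ δ ∈ B ∧ φ δ ≤ δ := by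
    intro δ h
    simp only [φ, dif_pos h]
    exact h.choose_spec
  let D : (Fin n →₀ ℕ) → Set (Fin n →₀ ℕ) := fun α => {δ | (∃ α ∈ B, α ≤ δ) ∧ φ δ = α}
  obtain ⟨h', hh'⟩ := exists_division_solution o B D (fun α => ι (t α)) (ι f) ht
  have hb := division_solution_bound o B D (fun α => ι (t α)) ht hh' hγ₀
  obtain ⟨h, rfl⟩ := hι.exists_solution o B D t f h' ht hh'
  choose q' hq' using fun α => hι.exists_restrict h (D α)
  choose q hq using fun α => hι.exists_shift (q' α) α
  obtain ⟨r, hr⟩ := hι.exists_restrict h {δ | ¬ ∃ α ∈ B, α ≤ δ}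
  have hsplit : ι h = ∑ α ∈ B, ι (q α) * monomial α 1 + ι r := by
    ext δ
    have hterm : ∀ α ∈ B, coeff δ (ι (q α) * monomial α 1) =
        if φ δ = α ∧ ∃ α ∈ B, α ≤ δ then coeff δ (ι h) else 0 := by
      intro α hα
      rw [coeff_mul_monomial, hq, coeff_shift, hq', coeff_restrict]
      by_cases hle : α ≤ δ
      · rw [if_pos hle, tsub_add_cancel_of_le hle, mul_one]
        by_cases h1 : φ δ = α ∧ ∃ α ∈ B, α ≤ δ
        · rw [if_pos h1, if_pos (show δ ∈ D α from h1.symm)]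
        · rw [if_neg h1, if_neg fun h2 : δ ∈ D α => h1 h2.symm]
      · rw [if_neg hle, if_neg]
        rintro ⟨rfl, h⟩
        exact hle (hφ δ h).2
    rw [map_add, map_sum, Finset.sum_congr rfl hterm, hr, coeff_restrict]
    by_cases hδ : ∃ α ∈ B, α ≤ δ
    · simp only [hδ, and_true]
      rw [Finset.sum_ite_eq, if_pos (hφ δ hδ).1]
      simp [hδ]
    · simp [hδ]
  refine ⟨q, r, hι.injective ?_, fun β hβ => ?_, fun α hα β hβ => ?_⟩
  · rw [← hh', hsplit, map_add, map_sum]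
    have : ∀ α ∈ B, ι (q α * g α) = ι (q α) * monomial α 1 +
        shift α (restrict (D α) (ι h)) * ι (t α) := by
      intro α _
      rw [← hq', ← hq]
      simp only [t, map_sub, map_mul, hm]
      ring
    rw [Finset.sum_congr rfl this, Finset.sum_add_distrib, ← hsplit]
    nth_rewrite 1 [hsplit]
    ring
  · rw [hr, mem_exponents_restrict] at hβ
    refine ⟨fun α hα hle => hβ.1 ⟨α, hα, hle⟩, hb β hβ.2⟩
  · rw [mem_exponents, hq, coeff_shift, hq'] at hβ
    exact hb _ (mem_exponents_restrict.1 hβ).2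

/-! ## Leading exponents of ideals -/

/-- The set of leading exponents of the elements of `I`. -/
def leadSet (ι : R →+* MvPowerSeries (Fin n) k) (I : Ideal R) (o : MonOrd n) :
    Set (Fin n →₀ ℕ) := {γ | ∃ f ∈ I, IsLead o (ι f) γ}

theorem Admissible.leadSet_upward (hι : Admissible ι) {I : Ideal R} {o : MonOrd n}
    {α β : Fin n →₀ ℕ} (hα : α ∈ leadSet ι I o) (h : α ≤ β) : β ∈ leadSet ι I o := by
  obtain ⟨f, hf, hl⟩ := hα
  obtain ⟨m, hm⟩ := hι.exists_monomial (β - α) 1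
  refine ⟨m * f, I.mul_mem_left _ hf, ?_⟩
  rw [map_mul, hm]
  simpa [tsub_add_cancel_of_le h] using hl.monomial_mul (β - α) one_ne_zero

/-- The minimal elements of a set of exponents, as a finset. -/
def minFinset (A : Set (Fin n →₀ ℕ)) : Finset (Fin n →₀ ℕ) := (finite_minimals A).toFinset

theorem mem_minFinset {A : Set (Fin n →₀ ℕ)} {α : Fin n →₀ ℕ} :
    α ∈ minFinset A ↔ Minimal (· ∈ A) α := Set.Finite.mem_toFinset _

theorem exists_minFinset_le {A : Set (Fin n →₀ ℕ)} {α : Fin n →₀ ℕ} (h : α ∈ A) :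
    ∃ γ ∈ minFinset A, γ ≤ α := by
  obtain ⟨γ, h1, h2⟩ := exists_minimals_le h
  exact ⟨γ, mem_minFinset.2 h1, h2⟩

theorem Admissible.exists_remainder (hι : Admissible ι) (I : Ideal R) (o : MonOrd n) (f : R)
    {γ₀ : Fin n →₀ ℕ} (hγ₀ : ∀ β ∈ exponents (ι f), ¬ o.lt β γ₀) :
    ∃ r : R, f - r ∈ I ∧ ∀ β ∈ exponents (ι r), β ∉ leadSet ι I o ∧ ¬ o.lt β γ₀ := by
  have key : ∀ α ∈ minFinset (leadSet ι I o), ∃ g ∈ I, IsLead o (ι g) α ∧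
      coeff α (ι g) = 1 := by
    intro α hα
    obtain ⟨f, hf, hl⟩ := (mem_minFinset.1 hα).prop
    obtain ⟨m, hm⟩ := hι.exists_monomial 0 (coeff α (ι f))⁻¹
    refine ⟨m * f, I.mul_mem_left _ hf, ?_, ?_⟩ <;> rw [map_mul, hm]
    · simpa using hl.monomial_mul 0 (inv_ne_zero hl.1)
    · have := coeff_add_monomial_mul (0 : Fin n →₀ ℕ) α (ι f) (coeff α (ι f))⁻¹
      rw [zero_add] at this
      rw [this, inv_mul_cancel₀ hl.1]
  choose! g hgI hg using key
  obtain ⟨q, r, h1, h2, -⟩ := hι.division o _ g hg f hγ₀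
  refine ⟨r, ?_, fun β hβ => ⟨fun hl => ?_, (h2 β hβ).2⟩⟩
  · rw [h1, add_sub_cancel_right]
    exact I.sum_mem fun α hα => I.mul_mem_left _ (hgI α hα)
  · obtain ⟨γ, hγ, hle⟩ := exists_minFinset_le hl
    exact (h2 β hβ).1 γ hγ hle

theorem eq_zero_of_exponents_notMem_leadSet {I : Ideal R} {o : MonOrd n} {f : R} (hf : f ∈ I)
    (h : ∀ β ∈ exponents (ι f), β ∉ leadSet ι I o) : ι f = 0 := by
  by_contra hne
  obtain ⟨γ, hγ⟩ := exists_isLead o hne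
  exact h γ hγ.1 ⟨f, hf, hγ⟩

/-- Monomials outside a set of leading exponents are independent modulo `I`. If `α` were leading
only for `o'`, the `o'`-remainder `r` of `x^α` would give `x^α - r` in `I` with no exponent leading
for `o`. This difference would be zero, yet its coefficient at `α` is `1`. -/
theorem Admissible.leadSet_eq_of_subset (hι : Admissible ι) {I : Ideal R} {o o' : MonOrd n}
    (h : leadSet ι I o ⊆ leadSet ι I o') : leadSet ι I o = leadSet ι I o' := by
  classical
  refine h.antisymm fun α hα => ?_
  by_contra hn
  obtain ⟨m, hm⟩ := hι.exists_monomial α 1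
  have hmexp : ∀ β ∈ exponents (ι m), β = α := by
    intro β hβ
    rw [hm, mem_exponents, coeff_monomial] at hβ
    by_contra hne
    simp [hne] at hβ
  obtain ⟨r, hr, hr'⟩ := hι.exists_remainder I o' m (γ₀ := α) (fun β hβ => by
    rw [hmexp β hβ]
    exact o'.irrefl)
  have h0 := eq_zero_of_exponents_notMem_leadSet (ι := ι) (o := o) hr fun β hβ => by
    rw [map_sub] at hβ
    rcases exponents_sub hβ with h1 | h1
    · rwa [hmexp β h1]
    · exact fun h2 => (hr' β h1).1 (h h2)
  have h1 : coeff α (ι r) = 0 := by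
    by_contra hne
    exact (hr' α hne).1 hα
  rw [map_sub] at h0
  have h2 := congrArg (coeff α) h0
  rw [map_sub, h1, hm, coeff_monomial] at h2
  simp at h2

/-- The elements `g α ∈ I`, for `α` a minimal element of `E`, have the form `x^α - (terms with
exponents outside of E)`. -/
def IsReducedBasis (ι : R →+* MvPowerSeries (Fin n) k) (I : Ideal R) (E : Set (Fin n →₀ ℕ))
    (g : (Fin n →₀ ℕ) → R) : Prop :=
  ∀ α ∈ minFinset E, g α ∈ I ∧ coeff α (ι (g α)) = 1 ∧
    ∀ β ∈ exponents (ι (g α)), β ∈ E → β = α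

theorem Admissible.exists_isReducedBasis (hι : Admissible ι) (I : Ideal R) (o : MonOrd n) :
    ∃ g, IsReducedBasis ι I (leadSet ι I o) g := by
  classical
  have key : ∀ α ∈ minFinset (leadSet ι I o), ∃ g ∈ I, coeff α (ι g) = 1 ∧
      ∀ β ∈ exponents (ι g), β ∈ leadSet ι I o → β = α := by
    intro α hα
    obtain ⟨m, hm⟩ := hι.exists_monomial α 1
    -- No exponent lies below `0`, so this choice imposes no condition.
    obtain ⟨r, hr, hr'⟩ := hι.exists_remainder I o m (γ₀ := 0)
      (fun β _ => o.not_lt_of_le zero_le)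
    refine ⟨m - r, hr, ?_, fun β hβ hβE => ?_⟩
    · have : coeff α (ι r) = 0 := by
        by_contra hne
        exact (hr' α hne).1 (mem_minFinset.1 hα).prop
      rw [map_sub, map_sub, this, hm, coeff_monomial]
      simp
    · rw [map_sub, hm] at hβ
      rcases exponents_sub hβ with h1 | h1
      · rw [mem_exponents, coeff_monomial] at h1
        by_contra hne
        simp [hne] at h1
      · exact absurd hβE (hr' β h1).1
  choose! g h1 h2 h3 using key
  exact ⟨g, fun α hα => ⟨h1 α hα, h2 α hα, h3 α hα⟩⟩

/-- The leading exponent of `g α` belongs to the set of leading exponents of `I`, and `α` is the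
only exponent of `g α` there. -/
theorem IsReducedBasis.isLead {I : Ideal R} {o : MonOrd n} {g : (Fin n →₀ ℕ) → R}
    (hg : IsReducedBasis ι I (leadSet ι I o) g) {α : Fin n →₀ ℕ}
    (hα : α ∈ minFinset (leadSet ι I o)) : IsLead o (ι (g α)) α := by
  obtain ⟨h1, h2, h3⟩ := hg α hα
  have hne : ι (g α) ≠ 0 := fun h0 => by simp [h0] at h2
  obtain ⟨γ, hγ⟩ := exists_isLead o hne
  exact h3 γ hγ.1 ⟨_, h1, hγ⟩ ▸ hγ

/-- If an order gives every `g α` the leading exponent `α`, it has the same leading exponents. -/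
theorem IsReducedBasis.leadSet_eq (hι : Admissible ι) {I : Ideal R} {o o' : MonOrd n}
    {g : (Fin n →₀ ℕ) → R} (hg : IsReducedBasis ι I (leadSet ι I o) g)
    (h : ∀ α ∈ minFinset (leadSet ι I o), IsLead o' (ι (g α)) α) :
    leadSet ι I o' = leadSet ι I o := by
  refine (hι.leadSet_eq_of_subset fun β hβ => ?_).symm
  obtain ⟨α, hα, hle⟩ := exists_minFinset_le hβ
  exact hι.leadSet_upward ⟨g α, (hg α hα).1, h α hα⟩ hle

/-- Since the order extends divisibility, being the leading exponent of an infinite series amounts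
to finitely many comparisons. This is what passes to limits of orders and yields finitely many
inequalities. -/
theorem isLead_iff_minFinset {o : MonOrd n} {f : MvPowerSeries (Fin n) k} {α : Fin n →₀ ℕ} :
    IsLead o f α ↔ α ∈ exponents f ∧ ∀ β ∈ minFinset (exponents f), β ≠ α → o.lt α β := by
  refine ⟨fun h => ⟨h.1, fun β hβ => h.2 β (mem_minFinset.1 hβ).prop⟩, fun h =>
    ⟨h.1, fun β hβ hne => ?_⟩⟩
  obtain ⟨γ, hγ, hle⟩ := exists_minFinset_le hβ
  rcases eq_or_ne γ α with rfl | h1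
  · exact o.lt_of_le_of_ne hle (Ne.symm hne)
  · rcases eq_or_ne γ β with rfl | h2
    · exact h.2 γ hγ h1
    · exact o.trans (h.2 γ hγ h1) (o.lt_of_le_of_ne hle h2)

/-- An ideal has only finitely many sets of leading exponents. -/
theorem Admissible.finite_range_leadSet (hι : Admissible ι) (I : Ideal R) :
    (Set.range (leadSet ι I)).Finite := by
  by_contra hinf
  have hinf : (Set.range (leadSet ι I)).Infinite := hinf
  -- A sequence of pairwise distinct sets of leading exponents, each realised by an order `s m`.
  let e := hinf.natEmbedding
  choose s hs using fun m => (e m).2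
  obtain ⟨g, hg⟩ := hι.exists_isReducedBasis I (MonOrd.limit s)
  have hev : ∀ᶠ m in Filter.hyperfilter ℕ, ∀ α ∈ minFinset (leadSet ι I (MonOrd.limit s)),
      IsLead (s m) (ι (g α)) α := by
    refine (Finset.eventually_all _).2 fun α hα => ?_
    have h1 := isLead_iff_minFinset.1 (hg.isLead hα)
    have h2 : ∀ᶠ m in Filter.hyperfilter ℕ, ∀ β ∈ minFinset (exponents (ι (g α))),
        β ≠ α → (s m).lt α β := by
      refine (Finset.eventually_all _).2 fun β hβ => ?_
      by_cases hne : β = α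
      · simp [hne]
      · exact (h1.2 β hβ hne).mono fun m hm _ => hm
    exact h2.mono fun m hm => isLead_iff_minFinset.2 ⟨h1.1, hm⟩
  have hev' := hev.mono fun m hm => hg.leadSet_eq hι hm
  have hsing : ∃ m₀, leadSet ι I (s m₀) = leadSet ι I (MonOrd.limit s) := hev'.exists
  obtain ⟨m₀, hm₀⟩ := hsing
  -- The ultrafilter is nonprincipal, so a second index besides `m₀` gives the same set, against
  -- distinctness.
  obtain ⟨m, hm, hne⟩ := (hev'.and (Filter.hyperfilter_le_cofinite
    (Set.finite_singleton m₀).compl_mem_cofinite)).exists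
  exact hne (e.injective (Subtype.ext (by rw [← hs, ← hs, hm, hm₀])))

end Division

/-! ## Initial ideals -/

section Initial

variable {k : Type*} [Field k] {n : ℕ}

open MvPowerSeries

theorem restrict_sum {σ : Type*} (s : Finset σ) (S : Set (Fin n →₀ ℕ))
    (f : σ → MvPowerSeries (Fin n) k) :
    restrict S (∑ i ∈ s, f i) = ∑ i ∈ s, restrict S (f i) := by
  ext α
  rw [coeff_restrict, map_sum, map_sum]
  simp only [coeff_restrict]
  split_ifs <;> simp

theorem restrict_add (S : Set (Fin n →₀ ℕ)) (f g : MvPowerSeries (Fin n) k) :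
    restrict S (f + g) = restrict S f + restrict S g := by
  ext α
  simp only [coeff_restrict, map_add]
  split_ifs <;> simp

/-- The exponents of `u`-weight `c`. -/
def level (u : Fin n → ℝ) (c : ℝ) : Set (Fin n →₀ ℕ) := {α | weight u α = c}

theorem mem_exponents_initialForm {u : Fin n → ℝ} {f : MvPowerSeries (Fin n) k}
    {α : Fin n →₀ ℕ} : α ∈ exponents (initialForm u f) ↔
      α ∈ exponents f ∧ ∀ β ∈ exponents f, weight u β ≤ weight u α := by
  rw [mem_exponents, coeff_initialForm, mem_exponents]
  split_ifs with h
  · exact ⟨fun h' => ⟨h', h⟩, fun h' => h'.1⟩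
  · simp only [ne_eq, not_true_eq_false, false_iff, not_and]
    exact fun _ => h

theorem coeff_initialForm_of_mem {u : Fin n → ℝ} {f : MvPowerSeries (Fin n) k}
    {α : Fin n →₀ ℕ} (h : α ∈ exponents (initialForm u f)) :
    coeff α (initialForm u f) = coeff α f := by
  rw [coeff_initialForm, if_pos (mem_exponents_initialForm.1 h).2]

theorem initialForm_eq_iff {u v : Fin n → ℝ} {f : MvPowerSeries (Fin n) k} :
    initialForm u f = initialForm v f ↔
      exponents (initialForm u f) = exponents (initialForm v f) := by
  refine ⟨fun h => by rw [h], fun h => MvPowerSeries.ext fun α => ?_⟩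
  by_cases hα : α ∈ exponents (initialForm u f)
  · rw [coeff_initialForm_of_mem hα, coeff_initialForm_of_mem (h ▸ hα)]
  · have hα' := hα
    rw [h] at hα'
    rw [mem_exponents, not_not] at hα hα'
    rw [hα, hα']

theorem initialForm_eq_restrict {u : Fin n → ℝ} {f : MvPowerSeries (Fin n) k} {γ : Fin n →₀ ℕ}
    (hγ : γ ∈ exponents f) (h : ∀ β ∈ exponents f, weight u β ≤ weight u γ) :
    initialForm u f = restrict (level u (weight u γ)) f := by
  ext α
  rw [coeff_initialForm, coeff_restrict]
  by_cases hα : α ∈ exponents f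
  · have : (∀ β ∈ exponents f, weight u β ≤ weight u α) ↔ α ∈ level u (weight u γ) :=
      ⟨fun h' => le_antisymm (h α hα) (h' γ hγ), fun h' => by
        rwa [show weight u α = weight u γ from h']⟩
    by_cases h' : α ∈ level u (weight u γ)
    · rw [if_pos h', if_pos (this.2 h')]
    · rw [if_neg h', if_neg fun h'' => h' (this.1 h'')]
  · rw [mem_exponents, not_not] at hα
    simp [hα]

theorem initialForm_zero (u : Fin n → ℝ) :
    initialForm u (0 : MvPowerSeries (Fin n) k) = 0 := by
  ext α
  rw [coeff_initialForm]
  simp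

theorem IsLead.weight_le {o : MonOrd n} {u : Fin n → ℝ} {hu : u ∈ Uloc n}
    {f : MvPowerSeries (Fin n) k} {γ : Fin n →₀ ℕ} (h : IsLead (o.refine hu) f γ) :
    ∀ β ∈ exponents f, weight u β ≤ weight u γ := fun β hβ => by
  rcases eq_or_ne β γ with rfl | hne
  · exact le_rfl
  · rcases h.2 β hβ hne with h1 | h1
    · exact h1.le
    · exact h1.1.le

/-- The bridge between orders and weights: the exponents surviving the comparison of `u`-weights are
those of the initial form, and `o` decides among them. -/
theorem isLead_refine_iff {o : MonOrd n} {u : Fin n → ℝ} {hu : u ∈ Uloc n}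
    {f : MvPowerSeries (Fin n) k} {γ : Fin n →₀ ℕ} :
    IsLead (o.refine hu) f γ ↔ IsLead o (initialForm u f) γ := by
  constructor
  · intro h
    refine ⟨mem_exponents_initialForm.2 ⟨h.1, h.weight_le⟩, fun β hβ hne => ?_⟩
    rw [mem_exponents_initialForm] at hβ
    rcases h.2 β hβ.1 hne with h1 | h1
    · exact absurd (hβ.2 γ h.1) (not_le.2 h1)
    · exact h1.2
  · intro h
    have h1 := mem_exponents_initialForm.1 h.1
    refine ⟨h1.1, fun β hβ hne => ?_⟩
    rcases (h1.2 β hβ).lt_or_eq with h2 | h2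
    · exact Or.inl h2
    · exact Or.inr ⟨h2, h.2 β (mem_exponents_initialForm.2 ⟨hβ, fun δ hδ =>
        (h1.2 δ hδ).trans_eq h2.symm⟩) hne⟩

/-- Under the bounds, exponents of the factors can add up to weight `a + b` only if both bounds are
attained. -/
theorem restrict_level_mul {u : Fin n → ℝ} {a b : ℝ} {p q : MvPowerSeries (Fin n) k}
    (hp : ∀ β ∈ exponents p, weight u β ≤ a) (hq : ∀ β ∈ exponents q, weight u β ≤ b) :
    restrict (level u (a + b)) (p * q) = restrict (level u a) p * restrict (level u b) q := by
  classical
  ext γ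
  rw [coeff_restrict, coeff_mul, coeff_mul]
  have key : ∀ x ∈ Finset.HasAntidiagonal.antidiagonal γ,
      coeff x.1 (restrict (level u a) p) * coeff x.2 (restrict (level u b) q) =
        if γ ∈ level u (a + b) then coeff x.1 p * coeff x.2 q else 0 := by
    intro x hx
    rw [← Finset.HasAntidiagonal.mem_antidiagonal.1 hx, coeff_restrict, coeff_restrict]
    by_cases h0 : coeff x.1 p * coeff x.2 q = 0
    · rw [h0]
      rcases mul_eq_zero.1 h0 with h | h <;> simp [h]
    have h1 := hp x.1 (left_ne_zero_of_mul h0)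
    have h2 := hq x.2 (right_ne_zero_of_mul h0)
    have h5 : x.1 + x.2 ∈ level u (a + b) ↔ x.1 ∈ level u a ∧ x.2 ∈ level u b := by
      simp only [level, Set.mem_ofPred_eq, weight_add]
      exact ⟨fun h => ⟨by linarith, by linarith⟩, fun h => by rw [h.1, h.2]⟩
    by_cases h3 : x.1 ∈ level u a
    · by_cases h4 : x.2 ∈ level u b
      · rw [if_pos h3, if_pos h4, if_pos (h5.2 ⟨h3, h4⟩)]
      · rw [if_neg h4, mul_zero, if_neg fun h => h4 (h5.1 h).2]
    · rw [if_neg h3, zero_mul, if_neg fun h => h3 (h5.1 h).1]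
  rw [Finset.sum_congr rfl key]
  split_ifs <;> simp

/-! ### Initial ideals and reduced bases. -/

variable {R : Type*} [CommRing R] {ι : R →+* MvPowerSeries (Fin n) k}

/-- The initial ideal, as a subset of `R`. -/
def initialSet (ι : R →+* MvPowerSeries (Fin n) k) (I : Ideal R) (u : Fin n → ℝ) : Set R :=
  (↑) '' (initialIdeal ι I u : Set (grRing ι u))

theorem mem_initialSet_of_eq {I : Ideal R} {u : Fin n → ℝ} {f g : R} (hf : f ∈ I)
    (hg : ι g = initialForm u (ι f)) : g ∈ initialSet ι I u := by
  have : g ∈ grRing ι u := by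
    change (weight u '' exponents (ι g)).Finite
    rw [hg]
    exact finite_weight_initialForm u _
  exact ⟨⟨g, this⟩, Ideal.subset_span ⟨f, hf, hg⟩, rfl⟩

theorem zero_mem_initialSet {I : Ideal R} {u : Fin n → ℝ} : (0 : R) ∈ initialSet ι I u :=
  ⟨0, Submodule.zero_mem _, rfl⟩

theorem add_mem_initialSet {I : Ideal R} {u : Fin n → ℝ} {f g : R}
    (hf : f ∈ initialSet ι I u) (hg : g ∈ initialSet ι I u) : f + g ∈ initialSet ι I u := by
  obtain ⟨x, hx, rfl⟩ := hf
  obtain ⟨y, hy, rfl⟩ := hg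
  exact ⟨x + y, Submodule.add_mem _ hx hy, rfl⟩

theorem sub_mem_initialSet {I : Ideal R} {u : Fin n → ℝ} {f g : R}
    (hf : f ∈ initialSet ι I u) (hg : g ∈ initialSet ι I u) : f - g ∈ initialSet ι I u := by
  obtain ⟨x, hx, rfl⟩ := hf
  obtain ⟨y, hy, rfl⟩ := hg
  exact ⟨x - y, Submodule.sub_mem _ hx hy, rfl⟩

theorem mul_mem_initialSet {I : Ideal R} {u : Fin n → ℝ} {a f : R} (ha : a ∈ grRing ι u)
    (hf : f ∈ initialSet ι I u) : a * f ∈ initialSet ι I u := by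
  obtain ⟨x, hx, rfl⟩ := hf
  exact ⟨⟨a, ha⟩ * x, Ideal.mul_mem_left _ _ hx, rfl⟩

theorem sum_mem_initialSet {I : Ideal R} {u : Fin n → ℝ} {σ : Type*} (s : Finset σ) {f : σ → R}
    (hf : ∀ i ∈ s, f i ∈ initialSet ι I u) : ∑ i ∈ s, f i ∈ initialSet ι I u := by
  classical
  induction s using Finset.induction_on with
  | empty => simpa using zero_mem_initialSet
  | insert i s hi ih =>
    rw [Finset.sum_insert hi]
    exact add_mem_initialSet (hf i (by simp)) (ih fun j hj => hf j (by simp [hj]))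

theorem Admissible.exists_initialForm (hι : Admissible ι) (u : Fin n → ℝ) (f : R) :
    ∃ g, ι g = initialForm u (ι f) := by
  obtain ⟨g, hg⟩ := hι.exists_restrict f (exponents (initialForm u (ι f)))
  refine ⟨g, ?_⟩
  rw [hg]
  ext α
  rw [coeff_restrict]
  split_ifs with h
  · rw [coeff_initialForm_of_mem h]
  · rw [mem_exponents, not_not] at h
    rw [h]

/-- The homogeneous components of the elements of `in_u(I)` are initial forms of elements
of `I`, or zero. -/
theorem Admissible.exists_level_eq (hι : Admissible ι) {I : Ideal R} {u : Fin n → ℝ} {h : R}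
    (hh : h ∈ initialSet ι I u) (c : ℝ) :
    ∃ f ∈ I, (∀ β ∈ exponents (ι f), weight u β ≤ c) ∧
      restrict (level u c) (ι h) = restrict (level u c) (ι f) := by
  classical
  obtain ⟨y, hy, rfl⟩ := hh
  replace hy : y ∈ Ideal.span {g : grRing ι u | ∃ f ∈ I, ι (g : R) = initialForm u (ι f)} := hy
  induction hy using Submodule.span_induction generalizing c with
  | mem x hx =>
    obtain ⟨f, hf, hx⟩ := hx
    rw [hx]
    by_cases hc : ∃ γ ∈ exponents (initialForm u (ι f)), weight u γ = c
    · obtain ⟨γ, hγ, rfl⟩ := hc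
      rw [mem_exponents_initialForm] at hγ
      refine ⟨f, hf, hγ.2, ?_⟩
      rw [initialForm_eq_restrict hγ.1 hγ.2]
      ext α
      simp only [coeff_restrict]
      split_ifs <;> rfl
    · refine ⟨0, I.zero_mem, fun β hβ => by simp [mem_exponents] at hβ, ?_⟩
      ext α
      rw [coeff_restrict, coeff_restrict, map_zero, map_zero, ite_self]
      split_ifs with hα
      · by_contra hne
        exact hc ⟨α, hne, hα⟩
      · rfl
  | zero => exact ⟨0, I.zero_mem, fun β hβ => by simp [mem_exponents] at hβ, rfl⟩
  | add x y _ _ hx hy =>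
    obtain ⟨f, hf, h1, h2⟩ := hx c
    obtain ⟨g, hg, h3, h4⟩ := hy c
    refine ⟨f + g, I.add_mem hf hg, fun β hβ => ?_, ?_⟩
    · by_cases hβf : β ∈ exponents (ι f)
      · exact h1 β hβf
      · refine h3 β fun h0 => hβ ?_
        rw [mem_exponents, not_not] at hβf
        rw [map_add, map_add, hβf, h0, add_zero]
    · rw [Subring.coe_add, map_add, map_add, restrict_add, restrict_add, h2, h4]
  | smul a x _ hx =>
    choose f hf h1 h2 using hx
    choose a' ha' using fun c' => hι.exists_restrict (a : R) (level u c')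
    have hW : (weight u '' exponents (ι (a : R))).Finite := a.2
    -- Each homogeneous part of `a` is paired with the lift of the complementary component of `x`.
    -- The sum is finite because `a` lies in the graded ring.
    refine ⟨∑ c' ∈ hW.toFinset, a' c' * f (c - c'),
      I.sum_mem fun c' _ => I.mul_mem_left _ (hf _), fun β hβ => ?_, ?_⟩
    · rw [mem_exponents, map_sum, map_sum] at hβ
      obtain ⟨c', -, hne⟩ := Finset.exists_ne_zero_of_sum_ne_zero hβ
      rw [map_mul] at hne
      obtain ⟨p, hp, q, hq, rfl⟩ := exponents_mul hne
      rw [ha', mem_exponents_restrict] at hp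
      rw [weight_add, show weight u p = c' from hp.1]
      linarith [h1 _ q hq]
    · ext γ
      rw [coeff_restrict, coeff_restrict]
      split_ifs with hγ
      · rw [smul_eq_mul, Subring.coe_mul, map_mul, coeff_mul, map_sum, map_sum]
        simp only [map_mul, coeff_mul]
        rw [Finset.sum_comm]
        refine Finset.sum_congr rfl fun p hp => ?_
        by_cases h0 : coeff p.1 (ι (a : R)) = 0
        · rw [h0, zero_mul]
          refine (Finset.sum_eq_zero fun c' _ => ?_).symm
          rw [ha', coeff_restrict, h0, ite_self, zero_mul]
        rw [Finset.sum_eq_single (weight u p.1)]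
        · rw [ha', coeff_restrict, if_pos (show p.1 ∈ level u (weight u p.1) from rfl)]
          congr 1
          have h3 := congrArg (coeff p.2) (h2 (c - weight u p.1))
          have h4 : p.2 ∈ level u (c - weight u p.1) := by
            have h5 : weight u γ = c := hγ
            rw [← Finset.HasAntidiagonal.mem_antidiagonal.1 hp, weight_add] at h5
            change weight u p.2 = _
            linarith
          rwa [coeff_restrict, coeff_restrict, if_pos h4, if_pos h4] at h3
        · intro c' _ hne
          rw [ha', coeff_restrict, if_neg fun h : p.1 ∈ level u c' => hne (Eq.symm h), zero_mul]
        · intro hn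
          exact absurd (hW.mem_toFinset.2 ⟨p.1, h0, rfl⟩) hn
      · rfl

/-- The leading exponents for the refined order are those of the initial ideal. -/
theorem Admissible.leadSet_refine (hι : Admissible ι) (I : Ideal R) (o : MonOrd n)
    {u : Fin n → ℝ} (hu : u ∈ Uloc n) :
    leadSet ι I (o.refine hu) = {γ | ∃ h ∈ initialSet ι I u, IsLead o (ι h) γ} := by
  ext γ
  constructor
  · rintro ⟨f, hf, hl⟩
    obtain ⟨h, hh⟩ := hι.exists_initialForm u f
    exact ⟨h, mem_initialSet_of_eq hf hh, by rwa [hh, ← isLead_refine_iff (hu := hu)]⟩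
  · rintro ⟨h, hh, hl⟩
    obtain ⟨f, hf, h1, h2⟩ := hι.exists_level_eq hh (weight u γ)
    have key : ∀ β, weight u β = weight u γ →
        (β ∈ exponents (ι f) ↔ β ∈ exponents (ι h)) := by
      intro β hβ
      have h3 := congrArg (coeff β) h2
      have hβ' : β ∈ level u (weight u γ) := hβ
      rw [coeff_restrict, coeff_restrict, if_pos hβ', if_pos hβ'] at h3
      rw [mem_exponents, mem_exponents, h3]
    refine ⟨f, hf, (key γ rfl).2 hl.1, fun β hβ hne => ?_⟩
    rcases (h1 β hβ).lt_or_eq with h3 | h3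
    · exact Or.inl h3
    · exact Or.inr ⟨h3, hl.2 β ((key β h3).1 hβ) hne⟩

theorem grRing_eq_of_support_eq {u w : Fin n → ℝ} (hu : u ∈ Uloc n) (hw : w ∈ Uloc n)
    (h : Function.support u = Function.support w) : grRing ι u = grRing ι w :=
  (grRing_le ι hu h.ge).antisymm (grRing_le ι hw h.le)

/-- The initial ideal is generated by the initial forms of a reduced basis. -/
theorem IsReducedBasis.initialSet_subset (hι : Admissible ι) {I : Ideal R} {o : MonOrd n}
    {u w : Fin n → ℝ} {hu : u ∈ Uloc n} {g : (Fin n →₀ ℕ) → R}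
    (hg : IsReducedBasis ι I (leadSet ι I (o.refine hu)) g) (hgr : grRing ι u = grRing ι w)
    (h : ∀ α ∈ minFinset (leadSet ι I (o.refine hu)),
      initialForm u (ι (g α)) = initialForm w (ι (g α))) :
    initialSet ι I u ⊆ initialSet ι I w := by
  rintro _ ⟨y, hy, rfl⟩
  replace hy : y ∈ Ideal.span {g : grRing ι u | ∃ f ∈ I, ι (g : R) = initialForm u (ι f)} := hy
  induction hy using Submodule.span_induction with
  | zero => exact zero_mem_initialSet
  | add x y _ _ hx hy => exact add_mem_initialSet hx hy
  | smul a x _ hx => exact mul_mem_initialSet (hgr ▸ a.2) hx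
  | mem y hy =>
    obtain ⟨f, hf, hy⟩ := hy
    by_cases h0 : ι f = 0
    · rw [h0, initialForm_zero, ← map_zero ι] at hy
      rw [hι.injective hy]
      exact zero_mem_initialSet
    obtain ⟨γ, hγ⟩ := exists_isLead (o.refine hu) h0
    obtain ⟨q, r, hfq, hr, hq⟩ := hι.division (o.refine hu) _ g
      (fun α hα => ⟨hg.isLead hα, (hg α hα).2.1⟩) f hγ.not_lt
    have hrI : r ∈ I := by
      rw [← sub_eq_iff_eq_add'.2 hfq]
      exact I.sub_mem hf (I.sum_mem fun α hα => I.mul_mem_left _ (hg α hα).1)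
    have hr0 : ι r = 0 := eq_zero_of_exponents_notMem_leadSet hrI fun β hβ hl => by
      obtain ⟨α, hα, hle⟩ := exists_minFinset_le hl
      exact (hr β hβ).1 α hα hle
    choose b hb using fun α => hι.exists_initialForm u (g α)
    -- The bound in the division says that no product `q α * g α` exceeds the `u`-weight of `γ`.
    -- Taking parts of that weight gives `in_u(f)` as a combination of the `in_u(g α)` with
    -- homogeneous coefficients.
    choose a ha using fun α => hι.exists_restrict (q α) (level u (weight u γ - weight u α))
    have hsum : (y : R) = ∑ α ∈ minFinset (leadSet ι I (o.refine hu)), a α * b α := by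
      refine hι.injective ?_
      rw [hy, initialForm_eq_restrict hγ.1 hγ.weight_le, hfq, map_add, hr0, add_zero, map_sum,
        map_sum, restrict_sum]
      refine Finset.sum_congr rfl fun α hα => ?_
      have hl := hg.isLead hα
      rw [map_mul, map_mul, ha, hb, initialForm_eq_restrict hl.1 hl.weight_le,
        ← restrict_level_mul _ hl.weight_le, sub_add_cancel]
      intro β hβ
      have h1 := hq α hα β hβ
      by_contra hlt
      refine h1 (Or.inl ?_)
      rw [weight_add]
      linarith
    rw [hsum]
    refine sum_mem_initialSet _ fun α hα => mul_mem_initialSet ?_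
      (mem_initialSet_of_eq (hg α hα).1 ((hb α).trans (h α hα)))
    rw [← hgr]
    change (weight u '' exponents (ι (a α))).Finite
    refine (Set.finite_singleton (weight u γ - weight u α)).subset ?_
    rintro _ ⟨β, hβ, rfl⟩
    rw [ha, mem_exponents_restrict] at hβ
    exact hβ.1

/-- Equivalence of weights is detected by the initial forms of a reduced basis. -/
theorem IsReducedBasis.weightEquiv_iff (hι : Admissible ι) {I : Ideal R} {o : MonOrd n}
    {u w : Fin n → ℝ} {hu : u ∈ Uloc n} (hw : w ∈ Uloc n) {g : (Fin n →₀ ℕ) → R}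
    (hg : IsReducedBasis ι I (leadSet ι I (o.refine hu)) g) :
    WeightEquiv ι I u w ↔ Function.support u = Function.support w ∧
      ∀ α ∈ minFinset (leadSet ι I (o.refine hu)),
        initialForm u (ι (g α)) = initialForm w (ι (g α)) := by
  refine and_congr_right fun hsupp => ⟨fun heq α hα => ?_, fun h => ?_⟩
  · have heq : initialSet ι I u = initialSet ι I w := heq
    have hE : leadSet ι I (o.refine hw) = leadSet ι I (o.refine hu) := by
      rw [hι.leadSet_refine, hι.leadSet_refine, heq]
    have hl := isLead_refine_iff.1 (hg.isLead hα)
    have hgw := hg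
    rw [← hE] at hgw
    have hl' := isLead_refine_iff.1 (hgw.isLead (hE ▸ hα))
    obtain ⟨a, ha⟩ := hι.exists_initialForm u (g α)
    obtain ⟨b, hb⟩ := hι.exists_initialForm w (g α)
    -- The difference of the two initial forms lies in the common initial ideal. If nonzero, its
    -- leading exponent would be a leading exponent of `I` occurring in `g α`, hence `α` itself; but
    -- both forms have the same coefficient there.
    have hmem : a - b ∈ initialSet ι I u := sub_mem_initialSet
      (mem_initialSet_of_eq (hg α hα).1 ha) (heq ▸ mem_initialSet_of_eq (hg α hα).1 hb)
    rw [← sub_eq_zero, ← ha, ← hb, ← map_sub]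
    by_contra hne
    obtain ⟨γ, hγ⟩ := exists_isLead o hne
    have hγE : γ ∈ leadSet ι I (o.refine hu) := by
      rw [hι.leadSet_refine]
      exact ⟨_, hmem, hγ⟩
    have hγg : γ ∈ exponents (ι (g α)) := by
      have := hγ.1
      rw [map_sub, ha, hb] at this
      rcases exponents_sub this with h | h <;> exact (mem_exponents_initialForm.1 h).1
    have hγα := (hg α hα).2.2 γ hγg hγE
    have := hγ.1
    rw [mem_exponents, map_sub, map_sub, hγα, ha, hb, coeff_initialForm_of_mem hl.1,
      coeff_initialForm_of_mem hl'.1, sub_self] at this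
    exact this rfl
  · have hgr : grRing ι u = grRing ι w := grRing_eq_of_support_eq hu hw hsupp
    -- Equal initial forms make `g` a reduced basis for `w` as well, so the inclusion of initial
    -- ideals can be used in both directions.
    have hE : leadSet ι I (o.refine hw) = leadSet ι I (o.refine hu) :=
      hg.leadSet_eq hι fun α hα => by
        rw [isLead_refine_iff, ← h α hα, ← isLead_refine_iff (hu := hu)]
        exact hg.isLead hα
    refine (hg.initialSet_subset hι hgr h).antisymm ?_
    have hgw := hg
    rw [← hE] at hgw
    exact hgw.initialSet_subset hι hgr.symm fun α hα => (h α (hE ▸ hα)).symm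

end Initial

/-! ## Fans of rational cones -/

section Polyhedral

variable {n : ℕ}

/-- The linear form with integer coefficient vector `a`. -/
def intForm (a : Fin n → ℤ) : StrongDual ℝ (Fin n → ℝ) :=
  ∑ i, (a i : ℝ) • ContinuousLinearMap.proj i

theorem intForm_apply (a : Fin n → ℤ) (x : Fin n → ℝ) : intForm a x = ∑ i, (a i : ℝ) * x i := by
  simp [intForm]

/-- The points that satisfy the inequalities of `S`, with equality where `w` has equality. -/
def closedCone (S : Finset (Fin n → ℤ)) (w : Fin n → ℝ) : Set (Fin n → ℝ) :=
  {x | ∀ a ∈ S, intForm a x ≤ 0 ∧ (intForm a w = 0 → intForm a x = 0)}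

/-- The relative interior of `closedCone S w`. -/
def openCone (S : Finset (Fin n → ℤ)) (w : Fin n → ℝ) : Set (Fin n → ℝ) :=
  {x | ∀ a ∈ S, (intForm a w < 0 → intForm a x < 0) ∧ (intForm a w = 0 → intForm a x = 0)}

theorem isClosed_closedCone (S : Finset (Fin n → ℤ)) (w : Fin n → ℝ) :
    IsClosed (closedCone S w) := by
  have : closedCone S w = ⋂ a ∈ S, {x | intForm a x ≤ 0} ∩
      ⋂ (_ : intForm a w = 0), {x | intForm a x = 0} := by
    ext x
    simp [closedCone]
  rw [this]
  exact isClosed_biInter fun a _ => (isClosed_le (intForm a).continuous continuous_const).inter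
    (isClosed_iInter fun _ => isClosed_eq (intForm a).continuous continuous_const)

/-- Moving a point of the closed cone slightly in the direction `w` makes every required inequality
strict and keeps the equalities. -/
theorem closure_openCone {S : Finset (Fin n → ℤ)} {w : Fin n → ℝ}
    (hw : ∀ a ∈ S, intForm a w ≤ 0) : closure (openCone S w) = closedCone S w := by
  refine subset_antisymm (closure_minimal (fun x hx a ha => ⟨?_, (hx a ha).2⟩)
    (isClosed_closedCone S w)) fun x hx => ?_
  · rcases (hw a ha).lt_or_eq with h | h
    · exact ((hx a ha).1 h).le
    · exact ((hx a ha).2 h).le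
  · have hlim : Filter.Tendsto (fun ε : ℝ => x + ε • w) (nhdsWithin 0 (Set.Ioi 0)) (nhds x) := by
      have : Filter.Tendsto (fun ε : ℝ => x + ε • w) (nhds 0) (nhds (x + (0 : ℝ) • w)) :=
        (by fun_prop : Continuous fun ε : ℝ => x + ε • w).tendsto 0
      rw [zero_smul, add_zero] at this
      exact this.mono_left nhdsWithin_le_nhds
    refine mem_closure_of_tendsto hlim ?_
    filter_upwards [self_mem_nhdsWithin] with ε hε a ha
    have hε : 0 < ε := hε
    simp only [map_add, map_smul, smul_eq_mul]
    refine ⟨fun h => ?_, fun h => ?_⟩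
    · have := mul_neg_of_pos_of_neg hε h
      linarith [(hx a ha).1]
    · rw [h, (hx a ha).2 h, mul_zero, add_zero]

theorem convex_closedCone (S : Finset (Fin n → ℤ)) (w : Fin n → ℝ) :
    Convex ℝ (closedCone S w) := by
  intro x hx y hy s t hs ht _ a ha
  simp only [map_add, map_smul, smul_eq_mul]
  refine ⟨?_, fun h => ?_⟩
  · have := mul_nonpos_of_nonneg_of_nonpos hs (hx a ha).1
    have := mul_nonpos_of_nonneg_of_nonpos ht (hy a ha).1
    linarith
  · rw [(hx a ha).2 h, (hy a ha).2 h, mul_zero, mul_zero, add_zero]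

theorem isRationalPolyhedralCone_closedCone (S : Finset (Fin n → ℤ)) (w : Fin n → ℝ) :
    IsRationalPolyhedralCone (closedCone S w) := by
  classical
  refine ⟨S ∪ (S.filter fun a => intForm a w = 0).image Neg.neg, ?_⟩
  have hneg : ∀ (a : Fin n → ℤ) x, ∑ i, ((-a) i : ℝ) * x i = -intForm a x := by
    intro a x
    simp [intForm_apply]
  ext x
  constructor
  · intro hx a ha
    rcases Finset.mem_union.1 ha with ha | ha
    · rw [← intForm_apply]
      exact (hx a ha).1
    · obtain ⟨b, hb, rfl⟩ := Finset.mem_image.1 ha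
      obtain ⟨hb, hbw⟩ := Finset.mem_filter.1 hb
      rw [hneg b x, (hx b hb).2 hbw, neg_zero]
  · intro hx a ha
    have h1 : intForm a x ≤ 0 := by
      rw [intForm_apply]
      exact hx a (Finset.mem_union_left _ ha)
    refine ⟨h1, fun hw => le_antisymm h1 ?_⟩
    have := hx (-a) (Finset.mem_union_right _
      (Finset.mem_image_of_mem _ (Finset.mem_filter.2 ⟨ha, hw⟩)))
    rw [hneg a x] at this
    linarith

/-- A convex set on which the forms of `S` are nonpositive has a point with the fewest
equalities. -/
theorem exists_generic {S : Finset (Fin n → ℤ)} {K : Set (Fin n → ℝ)} (hK : Convex ℝ K)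
    (hne : K.Nonempty) (hS : ∀ x ∈ K, ∀ a ∈ S, intForm a x ≤ 0) :
    ∃ w ∈ K, K ⊆ closedCone S w := by
  classical
  let T : (Fin n → ℝ) → Finset (Fin n → ℤ) := fun x => S.filter fun a => intForm a x = 0
  obtain ⟨w, hw, hmin⟩ := exists_minimalFor_of_wellFoundedLT (· ∈ K) (fun x => (T x).card) hne
  refine ⟨w, hw, fun x hx a ha => ⟨hS x hx a ha, fun haw => ?_⟩⟩
  -- A form that is nonpositive at `x` and `w` vanishes at the midpoint only if it vanishes at both;
  -- minimality of `w` then forces the equalities of `w` on `x`.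
  let m : Fin n → ℝ := (1 / 2 : ℝ) • x + (1 / 2 : ℝ) • w
  have hm : m ∈ K := hK hx hw (by norm_num) (by norm_num) (by norm_num)
  have hTm : ∀ b ∈ T m, intForm b x = 0 ∧ intForm b w = 0 := by
    intro b hb
    obtain ⟨hbS, hb⟩ := Finset.mem_filter.1 hb
    simp only [m, map_add, map_smul, smul_eq_mul] at hb
    have h1 := hS x hx b hbS
    have h2 := hS w hw b hbS
    constructor <;> linarith
  have hsub : T m ⊆ T w := fun b hb =>
    Finset.mem_filter.2 ⟨(Finset.mem_filter.1 hb).1, (hTm b hb).2⟩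
  have hTw : T m = T w := Finset.eq_of_subset_of_card_le hsub
    (hmin hm (Finset.card_le_card hsub))
  exact (hTm a (hTw ▸ Finset.mem_filter.2 ⟨ha, haw⟩)).1

/-- The sum of the forms vanishing at `w` has maximum `0` on the cone, attained exactly where every
summand vanishes. -/
theorem isFace_closedCone {S : Finset (Fin n → ℤ)} {u w : Fin n → ℝ}
    (hw : w ∈ closedCone S u) : IsFace (closedCone S u) (closedCone S w) := by
  classical
  have hww : w ∈ closedCone S w := fun a ha => ⟨(hw a ha).1, id⟩
  refine ⟨⟨w, hww⟩, fun _ => ⟨∑ a ∈ S.filter (fun a => intForm a w = 0), intForm a, ?_⟩⟩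
  have hle : ∀ y ∈ closedCone S u,
      ∑ a ∈ S.filter (fun a => intForm a w = 0), intForm a y ≤ 0 := fun y hy =>
    Finset.sum_nonpos fun a ha => (hy a (Finset.mem_filter.1 ha).1).1
  have hw0 : ∑ a ∈ S.filter (fun a => intForm a w = 0), intForm a w = 0 :=
    Finset.sum_eq_zero fun a ha => (Finset.mem_filter.1 ha).2
  ext x
  simp only [Set.mem_ofPred_eq, sum_apply]
  constructor
  · intro hx
    refine ⟨fun a ha => ⟨(hx a ha).1, fun hu => (hx a ha).2 ((hw a ha).2 hu)⟩, fun y hy => ?_⟩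
    rw [Finset.sum_eq_zero (f := fun a => intForm a x) fun a ha =>
      (hx a (Finset.mem_filter.1 ha).1).2 (Finset.mem_filter.1 ha).2]
    exact hle y hy
  · rintro ⟨hx, hmax⟩ a ha
    refine ⟨(hx a ha).1, fun haw => ?_⟩
    have h0 := le_antisymm (hle x hx) (hw0.symm.le.trans (hmax w hw))
    exact (Finset.sum_eq_zero_iff_of_nonpos
      (fun b hb => (hx b (Finset.mem_filter.1 hb).1).1)).1 h0 a (Finset.mem_filter.2 ⟨ha, haw⟩)

/-- A generic point `w` of the face determines it. For `x` in `closedCone S w`, the segment from `x`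
to `w` can be prolonged a little beyond `w` inside the cone, so a linear form maximal at `w` is
maximal at `x` too. -/
theorem exists_eq_closedCone_of_isFace {S : Finset (Fin n → ℤ)} {u : Fin n → ℝ}
    {F : Set (Fin n → ℝ)} (hF : IsFace (closedCone S u) F) :
    ∃ w ∈ closedCone S u, F = closedCone S w := by
  classical
  obtain ⟨hne, hexp⟩ := hF
  have hFP : F ⊆ closedCone S u := hexp.subset
  obtain ⟨w, hw, hsub⟩ := exists_generic (S := S) (hexp.convex (convex_closedCone S u)) hne
    fun x hx a ha => (hFP hx a ha).1
  refine ⟨w, hFP hw, hsub.antisymm fun x hx => ?_⟩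
  obtain ⟨l, hl⟩ := hexp hne
  have hwP := hFP hw
  have hxP : x ∈ closedCone S u := fun a ha =>
    ⟨(hx a ha).1, fun h => (hx a ha).2 ((hwP a ha).2 h)⟩
  have hev : ∀ᶠ ε : ℝ in nhdsWithin 0 (Set.Ioi 0), ∀ a ∈ S,
      intForm a w + ε * (intForm a w - intForm a x) ≤ 0 ∧
        (intForm a u = 0 → intForm a w + ε * (intForm a w - intForm a x) = 0) := by
    refine (Finset.eventually_all S).2 fun a ha => ?_
    rcases (hwP a ha).1.lt_or_eq with h | h
    · have hlim : Filter.Tendsto (fun ε : ℝ => intForm a w + ε * (intForm a w - intForm a x))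
          (nhds 0) (nhds (intForm a w + 0 * (intForm a w - intForm a x))) :=
        (by fun_prop : Continuous fun ε : ℝ =>
          intForm a w + ε * (intForm a w - intForm a x)).tendsto 0
      rw [zero_mul, add_zero] at hlim
      filter_upwards [(hlim.mono_left nhdsWithin_le_nhds).eventually_lt_const h] with ε hε
      exact ⟨hε.le, fun hu => absurd ((hwP a ha).2 hu) h.ne⟩
    · refine Filter.Eventually.of_forall fun ε => ?_
      rw [h, (hx a ha).2 h]
      simp
  obtain ⟨ε, hε, hε0⟩ := (hev.and self_mem_nhdsWithin).exists
  have hε0 : 0 < ε := hε0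
  have hz : w + ε • (w - x) ∈ closedCone S u := by
    intro a ha
    simpa only [map_add, map_smul, map_sub, smul_eq_mul] using hε a ha
  rw [hl] at hw ⊢
  refine ⟨hxP, fun y hy => (hw.2 y hy).trans ?_⟩
  have := hw.2 _ hz
  simp only [map_add, map_smul, map_sub, smul_eq_mul] at this
  by_contra hlt
  have := mul_pos hε0 (sub_pos.2 (not_le.1 hlt))
  linarith

/-- The hypothesis covers every `w` in the closed cone of `S`, not only `u`. Hence all faces are
closures of some `C w`, and a point lying in two cones has its class described by both systems. -/
theorem isRationalPolyhedralFan_of_openCone {U : Set (Fin n → ℝ)}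
    {C : (Fin n → ℝ) → Set (Fin n → ℝ)} {𝒮 : Set (Finset (Fin n → ℤ))} (h𝒮 : 𝒮.Finite)
    (h : ∀ u ∈ U, ∃ S ∈ 𝒮, (∀ a ∈ S, intForm a u ≤ 0) ∧
      ∀ w, (∀ a ∈ S, intForm a w ≤ 0) → w ∈ U ∧ C w = openCone S w) :
    IsRationalPolyhedralFan ((fun u => closure (C u)) '' U) := by
  classical
  have key : ∀ u ∈ U, ∃ S ∈ 𝒮, closure (C u) = closedCone S u ∧ u ∈ closedCone S u ∧
      ∀ w ∈ closedCone S u, w ∈ U ∧ closure (C w) = closedCone S w := by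
    intro u hu
    obtain ⟨S, hS, h1, h2⟩ := h u hu
    refine ⟨S, hS, by rw [(h2 u h1).2, closure_openCone h1], fun a ha => ⟨h1 a ha, id⟩,
      fun w hw => ?_⟩
    have hw' : ∀ a ∈ S, intForm a w ≤ 0 := fun a ha => (hw a ha).1
    exact ⟨(h2 w hw').1, by rw [(h2 w hw').2, closure_openCone hw']⟩
  have hinter : ∀ u ∈ U, ∀ u' ∈ U, IsFace (closure (C u)) (closure (C u) ∩ closure (C u')) := by
    intro u hu u' hu'
    obtain ⟨S, -, h1, -, h3⟩ := key u hu
    obtain ⟨S', -, h1', -, h3'⟩ := key u' hu'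
    rw [h1, h1']
    obtain ⟨w, hw, hsub⟩ := exists_generic (S := S)
      ((convex_closedCone S u).inter (convex_closedCone S' u'))
      ⟨0, fun a _ => by simp, fun a _ => by simp⟩ fun x hx a ha => (hx.1 a ha).1
    have heq : closedCone S u ∩ closedCone S' u' = closedCone S w := by
      refine hsub.antisymm (Set.subset_inter ?_ ?_)
      · exact fun x hx a ha => ⟨(hx a ha).1, fun h => (hx a ha).2 ((hw.1 a ha).2 h)⟩
      -- Both systems describe the closure of `C w`, so the face of the first cone through `w` is
      -- also a face of the second.
      · rw [← (h3 w hw.1).2, (h3' w hw.2).2]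
        exact fun x hx a ha => ⟨(hx a ha).1, fun h => (hx a ha).2 ((hw.2 a ha).2 h)⟩
    rw [heq]
    exact isFace_closedCone hw.1
  refine ⟨?_, ?_, ?_, ?_⟩
  -- For fixed `S`, the cone depends on `u` only through the subset `T` of forms vanishing at `u`.
  · refine (h𝒮.biUnion fun S _ => (S.powerset.finite_toSet.image fun T =>
      {x : Fin n → ℝ | ∀ a ∈ S, intForm a x ≤ 0 ∧ (a ∈ T → intForm a x = 0)})).subset ?_
    rintro _ ⟨u, hu, rfl⟩
    obtain ⟨S, hS, h1, -⟩ := key u hu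
    refine Set.mem_biUnion hS ⟨S.filter fun a => intForm a u = 0,
      Finset.mem_coe.2 (Finset.mem_powerset.2 (Finset.filter_subset _ _)), ?_⟩
    simp only [h1]
    ext x
    refine forall₂_congr fun a ha => ?_
    simp [ha]
  · rintro _ ⟨u, hu, rfl⟩
    obtain ⟨S, -, h1, -⟩ := key u hu
    simp only [h1]
    exact isRationalPolyhedralCone_closedCone S u
  · rintro _ ⟨u, hu, rfl⟩ F hF
    obtain ⟨S, -, h1, -, h3⟩ := key u hu
    simp only [h1] at hF
    obtain ⟨w, hw, rfl⟩ := exists_eq_closedCone_of_isFace hF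
    exact ⟨w, (h3 w hw).1, (h3 w hw).2⟩
  · rintro _ ⟨u, hu, rfl⟩ _ ⟨u', hu', rfl⟩
    refine ⟨hinter u hu u' hu', ?_⟩
    have := hinter u' hu' u hu
    rwa [Set.inter_comm] at this

end Polyhedral

/-! ## The Gröbner fan -/

section Fan

variable {k : Type*} [Field k] {n : ℕ} {R : Type*} [CommRing R]
  {ι : R →+* MvPowerSeries (Fin n) k}

open Classical in
/-- The inequalities that describe the cone of the weights for which the elements `g α` have
leading exponent `α`. -/
def constraints (ι : R →+* MvPowerSeries (Fin n) k) (E : Set (Fin n →₀ ℕ))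
    (g : (Fin n →₀ ℕ) → R) : Finset (Fin n → ℤ) :=
  Finset.univ.image (fun i => Pi.single i 1) ∪ (minFinset E).biUnion fun α =>
    (minFinset (exponents (ι (g α)))).image fun β i => (β i : ℤ) - α i

theorem forall_mem_constraints {E : Set (Fin n →₀ ℕ)} {g : (Fin n →₀ ℕ) → R}
    {p : (Fin n → ℤ) → Prop} : (∀ a ∈ constraints ι E g, p a) ↔
      (∀ i, p (Pi.single i 1)) ∧ ∀ α ∈ minFinset E, ∀ β ∈ minFinset (exponents (ι (g α))),
        p fun i => (β i : ℤ) - α i := by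
  classical
  constructor
  · intro h
    refine ⟨fun i => h _ (Finset.mem_union_left _ (Finset.mem_image_of_mem _
      (Finset.mem_univ i))), fun α hα β hβ => h _ (Finset.mem_union_right _
      (Finset.mem_biUnion.2 ⟨α, hα, Finset.mem_image_of_mem _ hβ⟩))⟩
  · rintro ⟨h1, h2⟩ a ha
    rcases Finset.mem_union.1 ha with ha | ha
    · obtain ⟨i, -, rfl⟩ := Finset.mem_image.1 ha
      exact h1 i
    · obtain ⟨α, hα, ha⟩ := Finset.mem_biUnion.1 ha
      obtain ⟨β, hβ, rfl⟩ := Finset.mem_image.1 ha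
      exact h2 α hα β hβ

theorem intForm_single (i : Fin n) (x : Fin n → ℝ) : intForm (Pi.single i 1) x = x i := by
  rw [intForm_apply, Finset.sum_eq_single i]
  · simp
  · intro j _ hj
    simp [Pi.single_eq_of_ne hj]
  · simp

theorem intForm_sub (α β : Fin n →₀ ℕ) (x : Fin n → ℝ) :
    intForm (fun i => (β i : ℤ) - α i) x = weight x β - weight x α := by
  rw [intForm_apply, weight, weight, ← Finset.sum_sub_distrib]
  refine Finset.sum_congr rfl fun i _ => ?_
  push_cast
  ring

theorem weight_eq_zero_iff {u : Fin n → ℝ} (hu : u ∈ Uloc n) (δ : Fin n →₀ ℕ) :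
    weight u δ = 0 ↔ ∀ i, u i = 0 ∨ δ i = 0 := by
  rw [weight, Finset.sum_eq_zero_iff_of_nonpos fun i _ =>
    mul_nonpos_of_nonpos_of_nonneg (hu i) (Nat.cast_nonneg _)]
  simp

theorem weight_le_of_minimals {u : Fin n → ℝ} (hu : u ∈ Uloc n) {A : Set (Fin n →₀ ℕ)} {c : ℝ}
    (h : ∀ β ∈ minFinset A, weight u β ≤ c) : ∀ β ∈ A, weight u β ≤ c := fun β hβ => by
  obtain ⟨γ, hγ, hle⟩ := exists_minFinset_le hβ
  exact (weight_anti hu hle).trans (h γ hγ)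

/-- Ties at arbitrary exponents reduce to ties at minimal ones. If `β` ties with `α` for `u` and `γ
≤ β` is minimal, then `γ` ties too and `β - γ` has `u`-weight zero. As `u ≤ 0`, it is supported
where `u` vanishes, hence where `v` does. -/
theorem exponents_initialForm_subset {u v : Fin n → ℝ} (hu : u ∈ Uloc n) (hv : v ∈ Uloc n)
    {f : MvPowerSeries (Fin n) k} {α : Fin n →₀ ℕ} (hα : α ∈ exponents f)
    (hmu : ∀ β ∈ exponents f, weight u β ≤ weight u α)
    (hmv : ∀ β ∈ exponents f, weight v β ≤ weight v α) (hsupp : ∀ i, u i = 0 → v i = 0)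
    (h : ∀ β ∈ minFinset (exponents f), weight u β = weight u α → weight v β = weight v α) :
    exponents (initialForm u f) ⊆ exponents (initialForm v f) := by
  intro β hβ
  rw [mem_exponents_initialForm] at hβ ⊢
  refine ⟨hβ.1, fun δ hδ => (hmv δ hδ).trans ?_⟩
  have h1 := hβ.2 α hα
  obtain ⟨γ, hγ, hle⟩ := exists_minFinset_le hβ.1
  have h2 := hmu γ (mem_minFinset.1 hγ).prop
  have hw : ∀ x : Fin n → ℝ, weight x β = weight x γ + weight x (β - γ) := fun x => by
    rw [← weight_add, add_tsub_cancel_of_le hle]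
  have h3 := weight_anti hu hle
  have h4 : weight u (β - γ) = 0 := by
    have := hw u
    linarith
  have h5 : weight v (β - γ) = 0 := by
    rw [weight_eq_zero_iff hu] at h4
    rw [weight_eq_zero_iff hv]
    exact fun i => (h4 i).imp_left (hsupp i)
  rw [hw v, h5, h γ hγ (by linarith), add_zero]

/-- Weak inequalities suffice: where `w` ties, `o` still prefers `α`. So refining `w` by `o` leaves
the leading exponents unchanged, and the same `g` serves on the whole closed cone, boundary
included. -/
theorem IsReducedBasis.groebnerCone_eq (hι : Admissible ι) {I : Ideal R} {o : MonOrd n}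
    {g : (Fin n →₀ ℕ) → R} (hg : IsReducedBasis ι I (leadSet ι I o) g) {w : Fin n → ℝ}
    (hw : ∀ a ∈ constraints ι (leadSet ι I o) g, intForm a w ≤ 0) :
    w ∈ Uloc n ∧ groebnerCone ι I w = openCone (constraints ι (leadSet ι I o) g) w := by
  obtain ⟨hw1, hw2⟩ := forall_mem_constraints.1 hw
  simp only [intForm_single] at hw1
  simp only [intForm_sub, sub_nonpos] at hw2
  have hwU : w ∈ Uloc n := hw1
  refine ⟨hwU, ?_⟩
  have hE : leadSet ι I (o.refine hwU) = leadSet ι I o := hg.leadSet_eq hι fun α hα => by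
    have hl := hg.isLead hα
    refine isLead_iff_minFinset.2 ⟨hl.1, fun β hβ hne => ?_⟩
    rcases (hw2 α hα β hβ).lt_or_eq with h | h
    · exact Or.inl h
    · exact Or.inr ⟨h, hl.2 β (mem_minFinset.1 hβ).prop hne⟩
  have hgw := hg
  rw [← hE] at hgw
  ext x
  have hopen : x ∈ openCone (constraints ι (leadSet ι I o) g) w ↔ _ :=
    forall_mem_constraints
  simp only [intForm_single, intForm_sub, sub_neg, sub_eq_zero] at hopen
  rw [hopen]
  have hmw : ∀ α ∈ minFinset (leadSet ι I o), ∀ β ∈ exponents (ι (g α)),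
      weight w β ≤ weight w α := fun α hα => weight_le_of_minimals hwU (hw2 α hα)
  constructor
  · rintro ⟨hxU, hx⟩
    obtain ⟨hsupp, hin⟩ := (hgw.weightEquiv_iff hι hxU).1 hx
    rw [hE] at hin
    have hs : ∀ i, w i = 0 ↔ x i = 0 := fun i => by
      simpa using not_congr (Set.ext_iff.1 hsupp i)
    refine ⟨fun i => ⟨fun h => lt_of_le_of_ne (hxU i) fun h' => h.ne ((hs i).2 h'), (hs i).1⟩,
      fun α hα β hβ => ?_⟩
    have hβ := (mem_minFinset.1 hβ).prop
    have hα1 : α ∈ exponents (initialForm w (ι (g α))) :=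
      mem_exponents_initialForm.2 ⟨(hg.isLead hα).1, hmw α hα⟩
    have hα2 := mem_exponents_initialForm.1 (hin α hα ▸ hα1)
    constructor
    · intro hlt
      refine lt_of_le_of_ne (hα2.2 β hβ) fun heq => ?_
      have h1 : β ∈ exponents (initialForm x (ι (g α))) :=
        mem_exponents_initialForm.2 ⟨hβ, fun δ hδ => (hα2.2 δ hδ).trans_eq heq.symm⟩
      rw [← hin α hα, mem_exponents_initialForm] at h1
      exact absurd (h1.2 α hα2.1) (not_le.2 hlt)
    · intro heq
      have h1 : β ∈ exponents (initialForm w (ι (g α))) :=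
        mem_exponents_initialForm.2 ⟨hβ, fun δ hδ => (hmw α hα δ hδ).trans_eq heq.symm⟩
      rw [hin α hα, mem_exponents_initialForm] at h1
      exact le_antisymm (hα2.2 β hβ) (h1.2 α hα2.1)
  · rintro ⟨hx1, hx2⟩
    have hxU : x ∈ Uloc n := fun i => by
      rcases (hw1 i).lt_or_eq with h | h
      · exact ((hx1 i).1 h).le
      · exact ((hx1 i).2 h).le
    have hs : ∀ i, w i = 0 ↔ x i = 0 := fun i =>
      ⟨(hx1 i).2, fun h => by
        by_contra hne
        exact ((hx1 i).1 (lt_of_le_of_ne (hw1 i) hne)).ne h⟩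
    refine ⟨hxU, (hgw.weightEquiv_iff hι hxU).2 ⟨?_, ?_⟩⟩
    · ext i
      exact not_congr (hs i)
    · rw [hE]
      intro α hα
      have hlα := (hg.isLead hα).1
      have hmx : ∀ β ∈ exponents (ι (g α)), weight x β ≤ weight x α :=
        weight_le_of_minimals hxU fun β hβ => by
          rcases (hw2 α hα β hβ).lt_or_eq with h | h
          · exact ((hx2 α hα β hβ).1 h).le
          · exact ((hx2 α hα β hβ).2 h).le
      refine initialForm_eq_iff.2 (subset_antisymm ?_ ?_)
      · exact exponents_initialForm_subset hwU hxU hlα (hmw α hα) hmx (fun i => (hs i).1)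
          fun β hβ => (hx2 α hα β hβ).2
      · refine exponents_initialForm_subset hxU hwU hlα hmx (hmw α hα) (fun i => (hs i).2)
          fun β hβ heq => ?_
        by_contra hne
        exact ((hx2 α hα β hβ).1 (lt_of_le_of_ne (hw2 α hα β hβ) hne)).ne heq

theorem Admissible.isRationalPolyhedralFan (hι : Admissible ι) (I : Ideal R) :
    IsRationalPolyhedralFan (closedGroebnerFan ι I) := by
  have hex : ∀ E ∈ Set.range (leadSet ι I), ∃ g, IsReducedBasis ι I E g := by
    rintro _ ⟨o, rfl⟩
    exact hι.exists_isReducedBasis I o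
  choose! g hg using hex
  refine isRationalPolyhedralFan_of_openCone
    ((hι.finite_range_leadSet I).image fun E => constraints ι E (g E)) fun u hu => ?_
  obtain ⟨o⟩ := MonOrd.nonempty (n := n)
  have hgu := hg _ ⟨o.refine hu, rfl⟩
  refine ⟨_, ⟨_, ⟨o.refine hu, rfl⟩, rfl⟩, ?_, fun w hw => hgu.groebnerCone_eq hι hw⟩
  refine forall_mem_constraints.2 ⟨fun i => ?_, fun α hα β hβ => ?_⟩
  · rw [intForm_single]
    exact hu i
  · rw [intForm_sub, sub_nonpos]
    exact (hgu.isLead hα).weight_le β (mem_minFinset.1 hβ).prop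

end Fan

/-! ## Division of convergent power series -/

section Convergent

variable {n : ℕ}

open MvPowerSeries

/-- The value of `x^α` at the point with coordinates `exp (-T Lᵢ)`. -/
def expWeight (L : Fin n → ℝ) (T : ℝ) (α : Fin n →₀ ℕ) : ℝ := Real.exp (-(T * weight L α))

theorem expWeight_pos (L : Fin n → ℝ) (T : ℝ) (α : Fin n →₀ ℕ) : 0 < expWeight L T α :=
  Real.exp_pos _

theorem expWeight_add (L : Fin n → ℝ) (T : ℝ) (α β : Fin n →₀ ℕ) :
    expWeight L T (α + β) = expWeight L T α * expWeight L T β := by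
  rw [expWeight, expWeight, expWeight, weight_add, ← Real.exp_add]
  ring_nf

theorem eventually_expWeight_le {L : Fin n → ℝ} (hL : ∀ i, 0 < L i) {r : ℝ} (hr : 0 < r) :
    ∀ᶠ T in Filter.atTop, ∀ α, expWeight L T α ≤ r ^ α.degree := by
  have h1 : ∀ i, ∀ᶠ T : ℝ in Filter.atTop, -Real.log r ≤ T * L i := fun i =>
    (Filter.tendsto_id.atTop_mul_const (hL i)).eventually_ge_atTop _
  filter_upwards [Filter.eventually_all.2 h1] with T hT α
  rw [← Real.exp_log hr, ← Real.exp_nat_mul, expWeight, Real.exp_le_exp,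
    Finsupp.degree_eq_sum, weight]
  push_cast
  rw [Finset.mul_sum, Finset.sum_mul, ← Finset.sum_neg_distrib]
  refine Finset.sum_le_sum fun i _ => ?_
  have := mul_le_mul_of_nonneg_right (hT i) (Nat.cast_nonneg (α := ℝ) (α i))
  linarith

theorem exists_pow_le_expWeight (L : Fin n → ℝ) {T : ℝ} (hT : 0 ≤ T) :
    ∃ r : ℝ, 0 < r ∧ ∀ α, r ^ α.degree ≤ expWeight L T α := by
  obtain ⟨M, hM⟩ := (Set.finite_range L).bddAbove
  refine ⟨Real.exp (-(T * M)), Real.exp_pos _, fun α => ?_⟩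
  rw [← Real.exp_nat_mul, expWeight, Real.exp_le_exp, Finsupp.degree_eq_sum, weight]
  push_cast
  rw [Finset.mul_sum, Finset.sum_mul, ← Finset.sum_neg_distrib]
  refine Finset.sum_le_sum fun i _ => ?_
  have h1 : L i ≤ M := hM ⟨i, rfl⟩
  have := mul_le_mul_of_nonneg_left (mul_le_mul_of_nonneg_right h1
    (Nat.cast_nonneg (α := ℝ) (α i))) hT
  linarith

theorem IsConvergent.eventually_summable {L : Fin n → ℝ} (hL : ∀ i, 0 < L i)
    {f : MvPowerSeries (Fin n) ℂ} (hf : IsConvergent f) :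
    ∀ᶠ T in Filter.atTop, Summable fun α => ‖coeff α f‖ * expWeight L T α := by
  obtain ⟨r, hr, hf⟩ := hf
  filter_upwards [eventually_expWeight_le hL hr] with T hT
  refine hf.of_nonneg_of_le (fun α => mul_nonneg (norm_nonneg _) (expWeight_pos _ _ _).le)
    fun α => ?_
  gcongr
  exact hT α

theorem isConvergent_of_summable (L : Fin n → ℝ) {T : ℝ} (hT : 0 ≤ T)
    {f : MvPowerSeries (Fin n) ℂ}
    (hf : Summable fun α => ‖coeff α f‖ * expWeight L T α) : IsConvergent f := by
  obtain ⟨r, hr, h⟩ := exists_pow_le_expWeight L hT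
  refine ⟨r, hr, hf.of_nonneg_of_le (fun _ => by positivity) fun α => ?_⟩
  gcongr
  exact h α

/-- If all exponents of `f` have larger `L`-weight than `α`, then `f` is small compared to `x^α`
at the points `exp (-T Lᵢ)`, `T → ∞`. -/
theorem IsConvergent.eventually_sum_le {L : Fin n → ℝ} (hL : ∀ i, 0 < L i)
    {f : MvPowerSeries (Fin n) ℂ} (hf : IsConvergent f) {α : Fin n →₀ ℕ}
    (h : ∀ β ∈ minFinset (exponents f), weight L α < weight L β) {ε : ℝ} (hε : 0 < ε) :
    ∀ᶠ T in Filter.atTop, ∀ s : Finset (Fin n →₀ ℕ),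
      ∑ β ∈ s, ‖coeff β f‖ * expWeight L T β ≤ ε * expWeight L T α := by
  obtain ⟨c, hcle, hc⟩ : ∃ c : ℝ, (∀ β ∈ minFinset (exponents f), c ≤ weight L β - weight L α) ∧
      0 < c := by
    -- Finitely many minimal exponents give a uniform gap `c`, and positivity of `L` extends it to
    -- all exponents. Passing from `T₀` to `T` then gains the factor `exp (-(T - T₀) c)` relative to
    -- `x^α`.
    have h1 : ∀ β ∈ minFinset (exponents f), ∀ᶠ c : ℝ in nhdsWithin 0 (Set.Ioi 0),
        c ≤ weight L β - weight L α := fun β hβ =>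
      nhdsWithin_le_nhds ((Filter.tendsto_id.eventually_lt_const (sub_pos.2 (h β hβ))).mono
        fun _ hx => hx.le)
    exact (((Finset.eventually_all _).2 h1).and self_mem_nhdsWithin).exists
  have hgap : ∀ β ∈ exponents f, c ≤ weight L β - weight L α := fun β hβ => by
    obtain ⟨γ, hγ, hle⟩ := exists_minFinset_le hβ
    exact (hcle γ hγ).trans (sub_le_sub_right (weight_mono (fun i => (hL i).le) hle) _)
  obtain ⟨T₀, hT₀⟩ := (hf.eventually_summable hL).exists
  have hlim : Filter.Tendsto (fun T : ℝ => (∑' β, ‖coeff β f‖ * expWeight L T₀ β) *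
      Real.exp (T₀ * weight L α) * Real.exp (-((T - T₀) * c))) Filter.atTop (nhds 0) := by
    rw [← mul_zero ((∑' β, ‖coeff β f‖ * expWeight L T₀ β) * Real.exp (T₀ * weight L α))]
    refine Filter.Tendsto.const_mul _ (Real.tendsto_exp_neg_atTop_nhds_zero.comp ?_)
    exact (Filter.tendsto_atTop_add_const_right _ _ Filter.tendsto_id).atTop_mul_const hc
  filter_upwards [hlim.eventually_le_const hε, Filter.eventually_ge_atTop T₀] with T hT hTT s
  refine le_trans ?_ (mul_le_mul_of_nonneg_right hT (expWeight_pos L T α).le)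
  have hterm : ∀ β ∈ s, ‖coeff β f‖ * expWeight L T β ≤
      ‖coeff β f‖ * expWeight L T₀ β * (Real.exp (T₀ * weight L α) *
        Real.exp (-((T - T₀) * c)) * expWeight L T α) := by
    intro β _
    by_cases h0 : coeff β f = 0
    · simp [h0]
    rw [mul_assoc]
    refine mul_le_mul_of_nonneg_left ?_ (norm_nonneg _)
    simp only [expWeight]
    rw [← Real.exp_add, ← Real.exp_add, ← Real.exp_add, Real.exp_le_exp]
    have := mul_le_mul_of_nonneg_left (hgap β h0) (sub_nonneg.2 hTT)
    linarith
  refine (Finset.sum_le_sum hterm).trans ?_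
  rw [← Finset.sum_mul, mul_assoc (∑' β, _) (Real.exp _) (Real.exp _),
    mul_assoc (∑' β, _) (Real.exp _ * Real.exp _)]
  refine mul_le_mul_of_nonneg_right (hT₀.sum_le_tsum s fun β _ =>
    mul_nonneg (norm_nonneg _) (expWeight_pos _ _ _).le) ?_
  exact (mul_pos (mul_pos (Real.exp_pos _) (Real.exp_pos _)) (expWeight_pos L T α)).le

theorem finite_weight_le {L : Fin n → ℝ} (hL : ∀ i, 0 < L i) (N : ℝ) :
    {γ : Fin n →₀ ℕ | weight L γ ≤ N}.Finite := by
  refine (Set.finite_Iic (Finsupp.equivFunOnFinite.symm fun i => ⌊N / L i⌋₊)).subset ?_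
  intro γ hγ i
  change γ i ≤ ⌊N / L i⌋₊
  refine Nat.le_floor ?_
  rw [le_div_iff₀ (hL i), mul_comm]
  exact (Finset.single_le_sum (fun j _ => mul_nonneg (hL j).le (Nat.cast_nonneg (γ j)))
    (Finset.mem_univ i)).trans hγ

/-- A norm estimate for the terms of the division equation, truncated by `L`-weight. -/
theorem sum_norm_shift_restrict_mul_le {L : Fin n → ℝ} (hL : ∀ i, 0 < L i) (T N : ℝ)
    {F : Finset (Fin n →₀ ℕ)} (hF : ∀ γ, γ ∈ F ↔ weight L γ ≤ N) (α : Fin n →₀ ℕ)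
    (D : Set (Fin n →₀ ℕ)) (h t : MvPowerSeries (Fin n) ℂ)
    (ht : ∀ β ∈ exponents t, weight L α ≤ weight L β) :
    (∑ γ ∈ F, ‖coeff γ (shift α (restrict D h) * t)‖ * expWeight L T γ) * expWeight L T α ≤
      (∑ γ ∈ F, ‖coeff γ h‖ * expWeight L T γ) * ∑ β ∈ F, ‖coeff β t‖ * expWeight L T β := by
  classical
  let W := expWeight L T
  have hW : ∀ γ, 0 ≤ W γ := fun γ => (expWeight_pos L T γ).le
  have hL0 : ∀ γ, 0 ≤ weight L γ := fun γ =>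
    Finset.sum_nonneg fun i _ => mul_nonneg (hL i).le (Nat.cast_nonneg _)
  let Q : (Fin n →₀ ℕ) → ℝ := fun a => if a + α ∈ F then ‖coeff (a + α) h‖ * W (a + α) else 0
  let V : (Fin n →₀ ℕ) → ℝ := fun b => ‖coeff b t‖ * W b
  have hQ : ∀ a, 0 ≤ Q a := fun a => by
    simp only [Q]
    split_ifs
    · exact mul_nonneg (norm_nonneg _) (hW _)
    · exact le_rfl
  have hV : ∀ b, 0 ≤ V b := fun b => mul_nonneg (norm_nonneg _) (hW _)
  have h1 : ∀ γ ∈ F, ‖coeff γ (shift α (restrict D h) * t)‖ * W γ * W α ≤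
      ∑ p ∈ Finset.HasAntidiagonal.antidiagonal γ, Q p.1 * V p.2 := by
    intro γ hγ
    rw [coeff_shift_restrict_mul, mul_assoc]
    refine (mul_le_mul_of_nonneg_right (norm_sum_le _ _)
      (mul_nonneg (hW _) (hW _))).trans ?_
    rw [Finset.sum_mul]
    refine Finset.sum_le_sum fun p hp => ?_
    have hpγ := Finset.HasAntidiagonal.mem_antidiagonal.1 hp
    by_cases h0 : coeff p.2 t = 0
    · rw [h0, mul_zero, norm_zero, zero_mul]
      exact mul_nonneg (hQ _) (hV _)
    -- Since exponents of `t` weigh at least as much as `α`, the truncated sum only involves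
    -- coefficients of `h` within the same truncation.
    have hmem : p.1 + α ∈ F := by
      rw [hF, weight_add]
      have h2 := (hF γ).1 hγ
      rw [← hpγ, weight_add] at h2
      linarith [ht _ h0]
    simp only [Q, V, if_pos hmem]
    have hnorm : ‖if p.1 + α ∈ D then coeff (p.1 + α) h else 0‖ ≤ ‖coeff (p.1 + α) h‖ := by
      split_ifs <;> simp
    rw [norm_mul, ← hpγ]
    simp only [W, expWeight_add]
    calc _ = ‖if p.1 + α ∈ D then coeff (p.1 + α) h else 0‖ * (‖coeff p.2 t‖ *
          (W p.1 * W p.2 * W α)) := by ring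
      _ ≤ ‖coeff (p.1 + α) h‖ * (‖coeff p.2 t‖ * (W p.1 * W p.2 * W α)) :=
        mul_le_mul_of_nonneg_right hnorm (mul_nonneg (norm_nonneg _)
          (mul_nonneg (mul_nonneg (hW _) (hW _)) (hW _)))
      _ = _ := by ring
  have h2 : ∑ γ ∈ F, ∑ p ∈ Finset.HasAntidiagonal.antidiagonal γ, Q p.1 * V p.2 ≤
      ∑ p ∈ F ×ˢ F, Q p.1 * V p.2 := by
    rw [← Finset.sum_biUnion]
    · refine Finset.sum_le_sum_of_subset_of_nonneg ?_ fun p _ _ => mul_nonneg (hQ _) (hV _)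
      intro p hp
      obtain ⟨γ, hγ, hp⟩ := Finset.mem_biUnion.1 hp
      rw [hF, ← Finset.HasAntidiagonal.mem_antidiagonal.1 hp, weight_add] at hγ
      rw [Finset.mem_product, hF, hF]
      exact ⟨by linarith [hL0 p.2], by linarith [hL0 p.1]⟩
    · intro γ _ γ' _ hne
      refine Finset.disjoint_left.2 fun p hp hp' => hne ?_
      rw [← Finset.HasAntidiagonal.mem_antidiagonal.1 hp,
        Finset.HasAntidiagonal.mem_antidiagonal.1 hp']
  have h3 : ∑ a ∈ F, Q a ≤ ∑ γ ∈ F, ‖coeff γ h‖ * W γ := by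
    simp only [Q]
    rw [← Finset.sum_filter]
    rw [← Finset.sum_image (f := fun γ => ‖coeff γ h‖ * W γ) (g := fun a => a + α)
      (fun a _ b _ hab => add_right_cancel hab)]
    refine Finset.sum_le_sum_of_subset_of_nonneg ?_ fun _ _ _ => mul_nonneg (norm_nonneg _) (hW _)
    intro γ hγ
    obtain ⟨a, ha, rfl⟩ := Finset.mem_image.1 hγ
    exact (Finset.mem_filter.1 ha).2
  calc _ = ∑ γ ∈ F, ‖coeff γ (shift α (restrict D h) * t)‖ * W γ * W α := Finset.sum_mul _ _ _
    _ ≤ ∑ p ∈ F ×ˢ F, Q p.1 * V p.2 := (Finset.sum_le_sum h1).trans h2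
    _ = (∑ a ∈ F, Q a) * ∑ b ∈ F, V b := by rw [Finset.sum_mul_sum, Finset.sum_product]
    _ ≤ _ := mul_le_mul_of_nonneg_right h3 (Finset.sum_nonneg fun b _ => hV b)

/-- In the norm at `exp (-T Lᵢ)` the correction operator has norm at most `1/2` for large `T`, so
`h` is bounded by twice the norm of `f`. Only finitely many comparisons of `o` enter, so a positive
weight `L` can replace it. -/
theorem isConvergent_of_division_solution (o : MonOrd n) (B : Finset (Fin n →₀ ℕ))
    (D : (Fin n →₀ ℕ) → Set (Fin n →₀ ℕ)) {t : (Fin n →₀ ℕ) → MvPowerSeries (Fin n) ℂ}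
    {f h : MvPowerSeries (Fin n) ℂ} (htc : ∀ α ∈ B, IsConvergent (t α)) (hfc : IsConvergent f)
    (ht : ∀ α ∈ B, ∀ β ∈ exponents (t α), o.lt α β)
    (hf : h + ∑ α ∈ B, shift α (restrict (D α) h) * t α = f) : IsConvergent h := by
  classical
  obtain ⟨L, hL, hLt⟩ := o.approx (B.biUnion fun α => (minFinset (exponents (t α))).image
    fun β => (α, β)) (by
      intro p hp
      obtain ⟨α, hα, hp⟩ := Finset.mem_biUnion.1 hp
      obtain ⟨β, hβ, rfl⟩ := Finset.mem_image.1 hp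
      exact ht α hα β (mem_minFinset.1 hβ).prop)
  have hLmin : ∀ α ∈ B, ∀ β ∈ minFinset (exponents (t α)), weight L α < weight L β :=
    fun α hα β hβ => hLt (α, β) (Finset.mem_biUnion.2 ⟨α, hα, Finset.mem_image_of_mem _ hβ⟩)
  have hLall : ∀ α ∈ B, ∀ β ∈ exponents (t α), weight L α ≤ weight L β := fun α hα β hβ => by
    obtain ⟨γ, hγ, hle⟩ := exists_minFinset_le hβ
    exact (hLmin α hα γ hγ).le.trans (weight_mono (fun i => (hL i).le) hle)
  -- The corrections from all of `B` then add up to at most one half; the `+ 1` covers empty `B`.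
  have hε : (0 : ℝ) < 1 / (2 * (B.card + 1)) := by positivity
  obtain ⟨T, ⟨hT1, hT2⟩, hT0⟩ := ((((Finset.eventually_all B).2 fun α hα =>
    (htc α hα).eventually_sum_le hL (hLmin α hα) hε).and (hfc.eventually_summable hL)).and
      (Filter.eventually_ge_atTop 0)).exists
  refine isConvergent_of_summable L hT0 ?_
  refine summable_of_sum_le
    (c := 2 * ∑' α, ‖coeff α f‖ * expWeight L T α)
    (fun α => mul_nonneg (norm_nonneg _) (expWeight_pos _ _ _).le) fun s => ?_
  -- Truncating by `L`-weight keeps `S` finite, so that `S / 2` can be absorbed before convergence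
  -- of `h` is known.
  obtain ⟨N, hN⟩ := (s.finite_toSet.image (weight L)).bddAbove
  let F := (finite_weight_le hL N).toFinset
  have hF : ∀ γ, γ ∈ F ↔ weight L γ ≤ N := fun γ => Set.Finite.mem_toFinset _
  have hsF : s ⊆ F := fun γ hγ => (hF γ).2 (hN ⟨γ, hγ, rfl⟩)
  refine (Finset.sum_le_sum_of_subset_of_nonneg hsF fun α _ _ =>
    mul_nonneg (norm_nonneg _) (expWeight_pos L T α).le).trans ?_
  set S := ∑ γ ∈ F, ‖coeff γ h‖ * expWeight L T γ with hS
  have hS0 : 0 ≤ S := Finset.sum_nonneg fun α _ =>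
    mul_nonneg (norm_nonneg _) (expWeight_pos L T α).le
  have h1 : ∀ α ∈ B, ∑ γ ∈ F, ‖coeff γ (shift α (restrict (D α) h) * t α)‖ * expWeight L T γ ≤
      S * (1 / (2 * (B.card + 1))) := by
    intro α hα
    have h2 := sum_norm_shift_restrict_mul_le hL T N hF α (D α) h (t α) (hLall α hα)
    have h3 := mul_le_mul_of_nonneg_left (hT1 α hα F) hS0
    rw [← mul_assoc] at h3
    exact le_of_mul_le_mul_right (h2.trans h3) (expWeight_pos L T α)
  have h2 : ∀ γ ∈ F, ‖coeff γ h‖ * expWeight L T γ ≤ ‖coeff γ f‖ * expWeight L T γ +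
      ∑ α ∈ B, ‖coeff γ (shift α (restrict (D α) h) * t α)‖ * expWeight L T γ := by
    intro γ _
    rw [← Finset.sum_mul, ← add_mul]
    refine mul_le_mul_of_nonneg_right ?_ (expWeight_pos L T γ).le
    have h3 := congrArg (coeff γ) (eq_sub_of_add_eq hf)
    rw [map_sub, map_sum] at h3
    rw [h3]
    exact (norm_sub_le _ _).trans (add_le_add_right (norm_sum_le _ _) _)
  have h3 : S ≤ (∑' α, ‖coeff α f‖ * expWeight L T α) + S / 2 := by
    refine (Finset.sum_le_sum h2).trans ?_
    rw [Finset.sum_add_distrib]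
    refine add_le_add (hT2.sum_le_tsum F fun β _ =>
      mul_nonneg (norm_nonneg _) (expWeight_pos _ _ _).le) ?_
    rw [Finset.sum_comm]
    refine (Finset.sum_le_sum h1).trans ?_
    rw [Finset.sum_const, nsmul_eq_mul]
    have : (0 : ℝ) < B.card + 1 := by positivity
    rw [show (B.card : ℝ) * (S * (1 / (2 * (B.card + 1)))) = S / 2 * (B.card / (B.card + 1)) by
      field_simp]
    refine mul_le_of_le_one_right (by positivity) ?_
    rw [div_le_one this]
    linarith
  linarith

theorem IsConvergent.restrict {f : MvPowerSeries (Fin n) ℂ} (hf : IsConvergent f)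
    (S : Set (Fin n →₀ ℕ)) : IsConvergent (restrict S f) := by
  obtain ⟨r, hr, hf⟩ := hf
  refine ⟨r, hr, hf.of_nonneg_of_le (fun _ => by positivity) fun α => ?_⟩
  gcongr
  rw [coeff_restrict]
  split_ifs <;> simp

theorem IsConvergent.shift {f : MvPowerSeries (Fin n) ℂ} (hf : IsConvergent f)
    (α : Fin n →₀ ℕ) : IsConvergent (shift α f) := by
  obtain ⟨r, hr, hf⟩ := hf
  refine ⟨r, hr, ?_⟩
  have h1 := (hf.comp_injective (add_left_injective α)).mul_right (r ^ α.degree)⁻¹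
  refine h1.congr fun β => ?_
  simp only [Function.comp_apply, coeff_shift, map_add, pow_add]
  field_simp

theorem isConvergent_monomial (α : Fin n →₀ ℕ) (c : ℂ) :
    IsConvergent (monomial α c : MvPowerSeries (Fin n) ℂ) := by
  classical
  refine ⟨1, one_pos, summable_of_hasFiniteSupport ((Set.finite_singleton α).subset ?_)⟩
  intro β hβ
  by_contra h
  simp only [Set.mem_singleton_iff] at h
  simp [coeff_monomial, h] at hβ

theorem admissible_convergent : Admissible (convergentPowerSeries n).subtype where
  injective := Subtype.val_injective
  exists_restrict f S := ⟨⟨_, IsConvergent.restrict f.2 S⟩, rfl⟩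
  exists_monomial α c := ⟨⟨_, isConvergent_monomial α c⟩, rfl⟩
  exists_shift f α := ⟨⟨_, IsConvergent.shift f.2 α⟩, rfl⟩
  exists_solution o B D t f h ht hf :=
    ⟨⟨h, isConvergent_of_division_solution o B D (fun α _ => (t α).2) f.2 ht hf⟩, rfl⟩

end Convergent

end LocalGroebnerFan

end

theorem mainTheorem1 (n : ℕ) (k : Type*) [Field k] :
    (∀ I : Ideal (MvPowerSeries (Fin n) k),
      LocalGroebnerFan.IsRationalPolyhedralFan
        (LocalGroebnerFan.closedGroebnerFan (RingHom.id (MvPowerSeries (Fin n) k)) I)) ∧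
    (∀ I : Ideal (LocalGroebnerFan.convergentPowerSeries n),
      LocalGroebnerFan.IsRationalPolyhedralFan
        (LocalGroebnerFan.closedGroebnerFan
          (LocalGroebnerFan.convergentPowerSeries n).subtype I)) :=
  ⟨fun I => LocalGroebnerFan.admissible_id.isRationalPolyhedralFan I,
    fun I => LocalGroebnerFan.admissible_convergent.isRationalPolyhedralFan I⟩
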